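/- \textbf{Setting.} Contextual LF has neutral terms $R::=x\mid \mathbf c\mid R\,N\mid u[\sigma]$, normal terms $M,N::=R\mid\lambda x.M$, substitutions $\sigma::=\cdot\mid \mathsf{wk}_\psi\mid\sigma,M$, atomic types $P::=\mathbf a\,M_1\cdots M_n$, and types $A,B::=P\mid \Pi\hat x{:}A.B\mid A\to B$ (in $A\to B$ the type $B$ does not depend on a new variable). LF contexts are $\Psi,\Phi::=\cdot\mid\psi\mid\Psi,x{:}A\mid\Psi,\hat x{:}A$, where $x{:}A$ is a proof-relevant assumption and $\hat x{:}A$ is a parameter. Meta types are $U::=(\Psi\vdash P)\mid G$ with $G$ a closed context schema (a non-empty list of alternatives $\exists\overrightarrow{(x{:}A_0)}.A$), meta terms are $C::=(\hat\Psi\vdash R)\mid\Psi$, meta contexts are $\Delta::=\cdot\mid\Delta,X{:}U$. Computation types are $\tau::=[\Psi\vdash P]\mid\tau_1\to\tau_2\mid\Pi^\Box X{:}U.\tau$, and $\Gamma::=\cdot\mid\Gamma,y{:}\tau$. A signature $\Sigma$, of declarations $\mathbf a{:}K$ and $\mathbf c{:}A$, is fixed. All substitutions $[M/x]$, $[\sigma]$,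 $[\![C/X]\!]$ are hereditary; $\Delta;\Psi\vdash M\Leftarrow A$ and $\Delta\Vdash C\Leftarrow U$ are the usual bidirectional typing judgements of contextual LF, with neutral terms checked at atomic types only ($x{:}A$ and $\hat x{:}A$ are not distinguished there), a context $\Psi$ being checked against a schema $G$ by matching each declaration with an instance of an alternative of $G$. The order of assumptions does not matter beyond dependency, so the assumption a rule acts on may stand anywhere in its context. \textbf{Sequents for LF}, $\Delta;\Psi\Longrightarrow M:A$ and $\Delta;\Psi\Longrightarrow\sigma:\Phi$. Every sequent has access to $\Sigma$: an \emph{available assumption} $R:A$ is a proof-relevant declaration $x{:}A$ of $\Psi$ or a declaration $\mathbf c{:}A$ of $\Sigma$. The rules are \begin{itemize} \item (init) $\Delta;\Psi\Longrightarrow R:A$ if $R:A$ is available; \item ($\Pi R$) from $\Delta;\Psi,\hat x{:}A\Longrightarrow M:B$ infer $\Delta;\Psi\Longrightarrow\lambda x.M:\Pi\hat x{:}A.B$; \item ($\to R$) from $\Delta;\Psi,x{:}A\Longrightarrow M:B$ infer $\Delta;\Psi\Longrightarrow\lambda x.M:A\to B$; \item ($\Pi L$) if $R:\Pi\hat x{:}A.B$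 is available, from $\Delta;\Psi\vdash M\Leftarrow A$ and $\Delta;\Psi,x_2{:}[M/\hat x]B\Longrightarrow N:A'$ infer $\Delta;\Psi\Longrightarrow[R\,M/x_2]N:A'$; \item ($\to L$) if $R:A\to B$ is available, from $\Delta;\Psi\Longrightarrow M:A$ and $\Delta;\Psi,x_2{:}B\Longrightarrow N:A'$ infer $\Delta;\Psi\Longrightarrow[R\,M/x_2]N:A'$; \item (reflect) if $u{:}(\Phi\vdash P)\in\Delta$, from $\Delta;\Psi\Longrightarrow\sigma:\Phi$ and $\Delta;\Psi,x{:}[\sigma]P\Longrightarrow M:A$ infer $\Delta;\Psi\Longrightarrow[u[\sigma]/x]M:A$; \item $\Delta;\Psi\Longrightarrow\cdot:\cdot$; $\ \Delta;\psi,\Psi\Longrightarrow\mathsf{wk}_\psi:\psi$; from $\Delta;\Psi\Longrightarrow\sigma:\Phi$ and $\Delta;\Psi\Longrightarrow N:[\sigma]B$ infer $\Delta;\Psi\Longrightarrow(\sigma,N):(\Phi,x{:}B)$; from $\Delta;\Psi\Longrightarrow\sigma:\Phi$ and $\Delta;\Psi\vdash M\Leftarrow[\sigma]B$ infer $\Delta;\Psi\Longrightarrow(\sigma,M):(\Phi,\hat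 x{:}B)$. \end{itemize} \textbf{Sequents for computations}, $\Delta;\Gamma\Longrightarrow E:\tau$, with the rules \begin{itemize} \item (init) $\Delta;\Gamma\Longrightarrow y:\tau$ if $y{:}\tau\in\Gamma$; \item ($\Pi^\Box R$) from $\Delta,X{:}U;\Gamma\Longrightarrow E:\tau$ infer $\Delta;\Gamma\Longrightarrow\lambda^\Box X.E:\Pi^\Box X{:}U.\tau$; \item ($\Pi^\Box L$) if $y_1{:}\Pi^\Box X{:}U.\tau'\in\Gamma$, from $\Delta\Vdash C\Leftarrow U$ and $\Delta;\Gamma,y_2{:}[\![C/X]\!]\tau'\Longrightarrow E:\tau$ infer $\Delta;\Gamma\Longrightarrow[y_1\,C/y_2]E:\tau$; \item ($\to R$) from $\Delta;\Gamma,y{:}\tau_1\Longrightarrow E:\tau_2$ infer $\Delta;\Gamma\Longrightarrow\mathsf{fn}\,y.E:\tau_1\to\tau_2$; \item ($\to L$) if $y_1{:}\tau_1\to\tau_2\in\Gamma$, from $\Delta;\Gamma\Longrightarrow E':\tau_1$ and $\Delta;\Gamma,y_2{:}\tau_2\Longrightarrow E:\tau$ infer $\Delta;\Gamma\Longrightarrow[y_1\,E'/y_2]E:\tau$;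 \item ($\Box R$) from $\Delta;\Psi\Longrightarrow R:P$ infer $\Delta;\Gamma\Longrightarrow[\hat\Psi\vdash R]:[\Psi\vdash P]$; \item ($\Box L$) if $y{:}[\Psi\vdash P]\in\Gamma$, from $\Delta,X{:}(\Psi\vdash P);\Gamma\Longrightarrow E:\tau$ infer $\Delta;\Gamma\Longrightarrow\mathsf{let\ box}\,X=y\ \mathsf{in}\ E:\tau$. \end{itemize} Write $\Delta;\Psi\Longrightarrow A$ and $\Delta;\Gamma\Longrightarrow\tau$ if the sequent is derivable with some proof term. \textbf{Lemma (Invertibility in the sequent calculi).} Let $\Sigma$ be a well-formed signature, and let the sequent in each hypothesis below be well-formed (well-formed contexts and succedent). \begin{enumerate} \item[a)] ($\Pi R$) If $\Delta;\Psi\Longrightarrow\Pi\hat x{:}A.B$ then $\Delta;\Psi,\hat x{:}A\Longrightarrow B$. \item[b)] ($\to R$) If $\Delta;\Psi\Longrightarrow A\to B$ then $\Delta;\Psi,x{:}A\Longrightarrow B$. \item[c)] ($\Pi^\Box R$) If $\Delta;\Gamma\Longrightarrow\Pi^\Box X{:}U.\tau$ then $\Delta,X{:}U;\Gamma\Longrightarrow\tau$.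 \item[d)] ($\to R$) If $\Delta;\Gamma\Longrightarrow\tau_1\to\tau_2$ then $\Delta;\Gamma,y{:}\tau_1\Longrightarrow\tau_2$. \item[e)] ($\Box L$) If $\Delta;\Gamma,y{:}[\Psi\vdash P]\Longrightarrow\tau$ then $\Delta,X{:}(\Psi\vdash P);\Gamma,y{:}[\Psi\vdash P]\Longrightarrow\tau$. \end{enumerate} -/

import Mathlib

namespace Beluga

/-! ### Raw expressions

De Bruijn indices throughout.  There are three independent families of variables: LF variables
(bound by `λ`, `Π` and LF contexts), contextual variables (meta-variables `u` and context
variables `ψ`, bound by meta-contexts, `Π□`, `λ□` and `let box`) and computation-level variables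
(bound by `fn` and computation-level contexts).  Constants are named by natural numbers. -/

mutual
/-- Neutral terms `R ::= x | c | R N | u[σ]`. -/
inductive Neu : Type
  | var : ℕ → Neu
  | const : ℕ → Neu
  | app : Neu → Nor → Neu
  | mvar : ℕ → Sub → Neu
/-- Normal terms `M, N ::= R | λx. M`. -/
inductive Nor : Type
  | neu : Neu → Nor
  | lam : Nor → Nor
/-- Substitutions `σ ::= · | wk_ψ | σ, M`. -/
inductive Sub : Type
  | empty : Sub
  | wk : ℕ → Sub
  | snoc : Sub → Nor → Sub
end

/-- Atomic types `a M₁ … Mₙ`. -/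
inductive Atm : Type
  | const : ℕ → Atm
  | app : Atm → Nor → Atm

/-- LF types: `P`, the universal quantification `Πx̂:A. B` (`B` is in the scope of `x̂`), and the
implication `A → B` (`B` is not in the scope of a new variable). -/
inductive Ty : Type
  | atom : Atm → Ty
  | pi : Ty → Ty → Ty
  | arr : Ty → Ty → Ty

/-- LF kinds `K ::= type | Πx:A. K`. -/
inductive Kind : Type
  | type : Kind
  | pi : Ty → Kind → Kind

/-- The two sorts of declarations in LF contexts: `x:A` (`proof`, a proof-relevant assumption) and
`x̂:A` (`param`, a parameter). -/
inductive Status : Type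
  | proof : Status
  | param : Status

/-- LF contexts `Ψ, Φ ::= · | ψ | Ψ, x:A | Ψ, x̂:A`. -/
inductive Ctx : Type
  | nil : Ctx
  | cvar : ℕ → Ctx
  | snoc : Ctx → Status → Ty → Ctx

/-- Context schemas `G ::= ∃(x⃗:A₀). A | G + ∃(x⃗:A₀). A`. -/
inductive Schema : Type
  | elem : Ctx → Ty → Schema
  | plus : Schema → Ctx → Ty → Schema

/-- Meta types `U ::= (Ψ ⊢ P) | G`. -/
inductive MTy : Type
  | term : Ctx → Atm → MTy
  | schema : Schema → MTy

/-- Erased contexts `Ψ̂`: the leading context variable, if any, and the number of variables. -/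
structure ECtx : Type where
  head : Option ℕ
  len : ℕ

/-- Meta terms `C ::= (Ψ̂ ⊢ R) | Ψ`. -/
inductive MTm : Type
  | term : ECtx → Neu → MTm
  | ctx : Ctx → MTm

/-- Meta contexts `Δ`; the head of the list is the declaration of index `0`. -/
abbrev MCtx : Type := List MTy

/-- Computation types `τ ::= [Ψ ⊢ P] | τ₁ → τ₂ | Π□X:U. τ`. -/
inductive CTy : Type
  | box : Ctx → Atm → CTy
  | arr : CTy → CTy → CTy
  | mpi : MTy → CTy → CTy

/-- Computation-level contexts `Γ`; the head of the list is the declaration of index `0`. -/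
abbrev CCtx : Type := List CTy

/-- Expressions
`E ::= y | [Ψ̂ ⊢ R] | let box X = E₁ in E₂ | fn y. E | E₁ E₂ | λ□X. E | E C`. -/
inductive Exp : Type
  | var : ℕ → Exp
  | box : ECtx → Neu → Exp
  | letbox : Exp → Exp → Exp
  | fn : Exp → Exp
  | app : Exp → Exp → Exp
  | mlam : Exp → Exp
  | mapp : Exp → MTm → Exp

/-- Declarations `a : K` and `c : A` of a signature. -/
inductive Decl : Type
  | tyc : ℕ → Kind → Decl
  | tmc : ℕ → Ty → Decl

/-- Signatures; the head of the list is the latest declaration. -/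
abbrev Sig : Type := List Decl

/-! ### Renamings -/

/-- A renaming pushed under one binder. -/
def up (r : ℕ → ℕ) : ℕ → ℕ
  | 0 => 0
  | i + 1 => r i + 1

mutual
/-- Renaming of LF variables. -/
def Neu.ren (r : ℕ → ℕ) : Neu → Neu
  | .var i => .var (r i)
  | .const c => .const c
  | .app R N => .app (R.ren r) (N.ren r)
  | .mvar u s => .mvar u (s.ren r)
/-- Renaming of LF variables. -/
def Nor.ren (r : ℕ → ℕ) : Nor → Nor
  | .neu R => .neu (R.ren r)
  | .lam M => .lam (M.ren (up r))
/-- Renaming of LF variables (`wk_ψ` does not mention any). -/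
def Sub.ren (r : ℕ → ℕ) : Sub → Sub
  | .empty => .empty
  | .wk p => .wk p
  | .snoc s M => .snoc (s.ren r) (M.ren r)
end

def Atm.ren (r : ℕ → ℕ) : Atm → Atm
  | .const a => .const a
  | .app P M => .app (P.ren r) (M.ren r)

def Ty.ren : (ℕ → ℕ) → Ty → Ty
  | r, .atom P => .atom (P.ren r)
  | r, .pi A B => .pi (A.ren r) (B.ren (up r))
  | r, .arr A B => .arr (A.ren r) (B.ren r)

/-- Weakening of an LF type by one LF variable. -/
def Ty.shift (A : Ty) : Ty := A.ren Nat.succ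

mutual
/-- Renaming of contextual variables. -/
def Neu.mren (r : ℕ → ℕ) : Neu → Neu
  | .var i => .var i
  | .const c => .const c
  | .app R N => .app (R.mren r) (N.mren r)
  | .mvar u s => .mvar (r u) (s.mren r)
/-- Renaming of contextual variables. -/
def Nor.mren (r : ℕ → ℕ) : Nor → Nor
  | .neu R => .neu (R.mren r)
  | .lam M => .lam (M.mren r)
/-- Renaming of contextual variables. -/
def Sub.mren (r : ℕ → ℕ) : Sub → Sub
  | .empty => .empty
  | .wk p => .wk (r p)
  | .snoc s M => .snoc (s.mren r) (M.mren r)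
end

def Atm.mren (r : ℕ → ℕ) : Atm → Atm
  | .const a => .const a
  | .app P M => .app (P.mren r) (M.mren r)

def Ty.mren (r : ℕ → ℕ) : Ty → Ty
  | .atom P => .atom (P.mren r)
  | .pi A B => .pi (A.mren r) (B.mren r)
  | .arr A B => .arr (A.mren r) (B.mren r)

def Ctx.mren (r : ℕ → ℕ) : Ctx → Ctx
  | .nil => .nil
  | .cvar p => .cvar (r p)
  | .snoc Ψ h A => .snoc (Ψ.mren r) h (A.mren r)

/-- Schemas are closed, so they are not affected. -/
def MTy.mren (r : ℕ → ℕ) : MTy → MTy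
  | .term Ψ P => .term (Ψ.mren r) (P.mren r)
  | .schema G => .schema G

def ECtx.mren (r : ℕ → ℕ) (e : ECtx) : ECtx := ⟨e.head.map r, e.len⟩

def MTm.mren (r : ℕ → ℕ) : MTm → MTm
  | .term e R => .term (e.mren r) (R.mren r)
  | .ctx Ψ => .ctx (Ψ.mren r)

def CTy.mren : (ℕ → ℕ) → CTy → CTy
  | r, .box Ψ P => .box (Ψ.mren r) (P.mren r)
  | r, .arr t₁ t₂ => .arr (t₁.mren r) (t₂.mren r)
  | r, .mpi U t => .mpi (U.mren r) (t.mren (up r))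

/-- Weakening of a computation type by one contextual variable. -/
def CTy.mshift (t : CTy) : CTy := t.mren Nat.succ

/-- Weakening of a computation-level context by one contextual variable. -/
def CCtx.mshift (Γ : CCtx) : CCtx := Γ.map CTy.mshift

/-- Renaming of contextual variables in expressions. -/
def Exp.mren : (ℕ → ℕ) → Exp → Exp
  | _, .var y => .var y
  | r, .box e R => .box (e.mren r) (R.mren r)
  | r, .letbox E₁ E₂ => .letbox (E₁.mren r) (E₂.mren (up r))
  | r, .fn E => .fn (E.mren r)
  | r, .app E₁ E₂ => .app (E₁.mren r) (E₂.mren r)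
  | r, .mlam E => .mlam (E.mren (up r))
  | r, .mapp E C => .mapp (E.mren r) (C.mren r)

/-- Renaming of computation-level variables in expressions. -/
def Exp.ren : (ℕ → ℕ) → Exp → Exp
  | r, .var y => .var (r y)
  | _, .box e R => .box e R
  | r, .letbox E₁ E₂ => .letbox (E₁.ren r) (E₂.ren r)
  | r, .fn E => .fn (E.ren (up r))
  | r, .app E₁ E₂ => .app (E₁.ren r) (E₂.ren r)
  | r, .mlam E => .mlam (E.ren r)
  | r, .mapp E C => .mapp (E.ren r) C

/-- Simultaneous capture-avoiding substitution for computation-level variables. -/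
def Exp.subst : (ℕ → Exp) → Exp → Exp
  | s, .var y => s y
  | _, .box e R => .box e R
  | s, .letbox E₁ E₂ => .letbox (E₁.subst s) (E₂.subst fun i => (s i).mren Nat.succ)
  | s, .fn E => .fn (E.subst fun i => i.casesOn (.var 0) fun j => (s j).ren Nat.succ)
  | s, .app E₁ E₂ => .app (E₁.subst s) (E₂.subst s)
  | s, .mlam E => .mlam (E.subst fun i => (s i).mren Nat.succ)
  | s, .mapp E C => .mapp (E.subst s) C

/-- `E.inst E'` is `[E'/y]E`, where `y` is the variable of index `0`. -/
def Exp.inst (E E' : Exp) : Exp := E.subst fun i => i.casesOn E' fun j => .var j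

/-! ### Lookup in contexts -/

/-- The declaration of the LF variable with index `i`, its type weakened to the whole context. -/
def Ctx.get : Ctx → ℕ → Option (Status × Ty)
  | .nil, _ => none
  | .cvar _, _ => none
  | .snoc _ h A, 0 => some (h, A.shift)
  | .snoc Ψ _ _, i + 1 => (Ψ.get i).map fun d => (d.1, d.2.shift)

/-- The context variable at the left end of a context, if any. -/
def Ctx.head : Ctx → Option ℕ
  | .nil => none
  | .cvar p => some p
  | .snoc Ψ _ _ => Ψ.head

/-- The number of variables declared in a context. -/
def Ctx.len : Ctx → ℕ
  | .nil => 0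
  | .cvar _ => 0
  | .snoc Ψ _ _ => Ψ.len + 1

/-- The erasure `Ψ̂` of `Ψ`. -/
def Ctx.erase (Ψ : Ctx) : ECtx := ⟨Ψ.head, Ψ.len⟩

/-- The type of the contextual variable with index `i`, weakened to the whole meta-context. -/
def MCtx.get (Δ : MCtx) (i : ℕ) : Option MTy :=
  (Δ[i]?).map fun U => U.mren fun j => j + (i + 1)

/-- `G.Elem Φ A`: the element `∃Φ. A` is one of the alternatives of `G`. -/
inductive Schema.Elem : Schema → Ctx → Ty → Prop
  | elem (Φ : Ctx) (A : Ty) : Schema.Elem (.elem Φ A) Φ A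
  | here (G : Schema) (Φ : Ctx) (A : Ty) : Schema.Elem (.plus G Φ A) Φ A
  | there (G : Schema) (Φ Φ' : Ctx) (A A' : Ty) :
      Schema.Elem G Φ A → Schema.Elem (.plus G Φ' A') Φ A

/-! ### Hereditary substitution

Hereditary substitution is a partial operation on raw normal forms: it contracts the redexes it
creates.  It is given by its graph.  An environment maps the LF variables in the domain of the
substitution to normal terms. -/

abbrev Env : Type := ℕ → Option Nor

/-- An environment pushed under a binder. -/
def Env.up (s : Env) : Env
  | 0 => some (.neu (.var 0))
  | i + 1 => (s i).map (Nor.ren Nat.succ)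

/-- The environment of `[N/x]`, where `x` is the variable of index `0`. -/
def Env.one (N : Nor) : Env
  | 0 => some N
  | i + 1 => some (.neu (.var i))

/-- The environment of a simultaneous substitution: its last entry belongs to index `0`. -/
def Sub.env : Sub → Env
  | .empty, _ => none
  | .wk _, _ => none
  | .snoc _ M, 0 => some M
  | .snoc s _, i + 1 => s.env i

mutual
/-- `HNeu s R M`: `[s]R = M`. -/
inductive HNeu : Env → Neu → Nor → Prop
  | var (s : Env) (i : ℕ) (M : Nor) : s i = some M → HNeu s (.var i) M
  | const (s : Env) (c : ℕ) : HNeu s (.const c) (.neu (.const c))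
  | app (s : Env) (R : Neu) (N M N' M' : Nor) :
      HNeu s R M → HNor s N N' → HApp M N' M' → HNeu s (.app R N) M'
  | mvar (s : Env) (u : ℕ) (t t₁ : Sub) : HSub s t t₁ → HNeu s (.mvar u t) (.neu (.mvar u t₁))
/-- `HNor s M M'`: `[s]M = M'`. -/
inductive HNor : Env → Nor → Nor → Prop
  | neu (s : Env) (R : Neu) (M : Nor) : HNeu s R M → HNor s (.neu R) M
  | lam (s : Env) (M M₁ : Nor) : HNor s.up M M₁ → HNor s (.lam M) (.lam M₁)
/-- `HApp M N M'`: the normal form of `M N` is `M'`. -/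
inductive HApp : Nor → Nor → Nor → Prop
  | neu (R : Neu) (N : Nor) : HApp (.neu R) N (.neu (.app R N))
  | beta (M N M₁ : Nor) : HNor (Env.one N) M M₁ → HApp (.lam M) N M₁
/-- `HSub s t t'`: `[s]t = t'`. -/
inductive HSub : Env → Sub → Sub → Prop
  | empty (s : Env) : HSub s .empty .empty
  | wk (s : Env) (p : ℕ) : HSub s (.wk p) (.wk p)
  | snoc (s : Env) (t t' : Sub) (M M' : Nor) :
      HSub s t t' → HNor s M M' → HSub s (.snoc t M) (.snoc t' M')
end

inductive HAtm : Env → Atm → Atm → Prop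
  | const (s : Env) (a : ℕ) : HAtm s (.const a) (.const a)
  | app (s : Env) (P P' : Atm) (M M' : Nor) :
      HAtm s P P' → HNor s M M' → HAtm s (.app P M) (.app P' M')

inductive HTy : Env → Ty → Ty → Prop
  | atom (s : Env) (P P' : Atm) : HAtm s P P' → HTy s (.atom P) (.atom P')
  | pi (s : Env) (A A' B B' : Ty) : HTy s A A' → HTy s.up B B' → HTy s (.pi A B) (.pi A' B')
  | arr (s : Env) (A A' B B' : Ty) : HTy s A A' → HTy s B B' → HTy s (.arr A B) (.arr A' B')

inductive HKind : Env → Kind → Kind → Prop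
  | type (s : Env) : HKind s .type .type
  | pi (s : Env) (A A₁ : Ty) (K K₁ : Kind) :
      HTy s A A₁ → HKind s.up K K₁ → HKind s (.pi A K) (.pi A₁ K₁)

/-! ### Hereditary meta-substitution

`[[C/X]]`, where `X` has index `k` and `C` is well-scoped after the removal of `X`.  The number `n`
counts the LF variables that are declared to the right of the leading context variable at the
place under consideration; it is needed because `wk_ψ` is replaced by the identity substitution on
the context that replaces `ψ`. -/

/-- The long normal form of a neutral term of a given type. -/
def etaExp : Ty → Neu → Nor
  | .atom _, R => .neu R
  | .pi A B, R => .lam (etaExp B (.app (R.ren Nat.succ) (etaExp A (.var 0))))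
  | .arr A B, R => .lam (etaExp B (.app (R.ren Nat.succ) (etaExp A (.var 0))))

/-- The identity substitution on `Φ`, as a substitution from `Φ` to `Φ` followed by `n` further
declarations. -/
def Ctx.idSub : Ctx → ℕ → Sub
  | .nil, _ => .empty
  | .cvar p, _ => .wk p
  | .snoc Φ _ A, n => .snoc (Φ.idSub (n + 1)) (etaExp A (.var n))

/-- The index of a contextual variable other than `k` after the removal of `k`. -/
def drop (k i : ℕ) : ℕ := if k < i then i - 1 else i

mutual
inductive MNeu : ℕ → MTm → ℕ → Neu → Nor → Prop
  | var (k : ℕ) (C : MTm) (n i : ℕ) : MNeu k C n (.var i) (.neu (.var i))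
  | const (k : ℕ) (C : MTm) (n c : ℕ) : MNeu k C n (.const c) (.neu (.const c))
  | app (k : ℕ) (C : MTm) (n : ℕ) (R : Neu) (N M N' M' : Nor) :
      MNeu k C n R M → MNor k C n N N' → HApp M N' M' → MNeu k C n (.app R N) M'
  | other (k : ℕ) (C : MTm) (n u : ℕ) (t t' : Sub) :
      u ≠ k → MSub k C n t t' → MNeu k C n (.mvar u t) (.neu (.mvar (drop k u) t'))
  | self (k : ℕ) (e : ECtx) (R : Neu) (n : ℕ) (t t' : Sub) (M : Nor) :
      MSub k (.term e R) n t t' → HNeu t'.env R M → MNeu k (.term e R) n (.mvar k t) M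
inductive MNor : ℕ → MTm → ℕ → Nor → Nor → Prop
  | neu (k : ℕ) (C : MTm) (n : ℕ) (R : Neu) (M : Nor) : MNeu k C n R M → MNor k C n (.neu R) M
  | lam (k : ℕ) (C : MTm) (n : ℕ) (M M' : Nor) :
      MNor k C (n + 1) M M' → MNor k C n (.lam M) (.lam M')
inductive MSub : ℕ → MTm → ℕ → Sub → Sub → Prop
  | empty (k : ℕ) (C : MTm) (n : ℕ) : MSub k C n .empty .empty
  | other (k : ℕ) (C : MTm) (n p : ℕ) : p ≠ k → MSub k C n (.wk p) (.wk (drop k p))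
  | self (k : ℕ) (Φ : Ctx) (n : ℕ) : MSub k (.ctx Φ) n (.wk k) (Φ.idSub n)
  | snoc (k : ℕ) (C : MTm) (n : ℕ) (t t' : Sub) (M M' : Nor) :
      MSub k C n t t' → MNor k C n M M' → MSub k C n (.snoc t M) (.snoc t' M')
end

inductive MAtm : ℕ → MTm → ℕ → Atm → Atm → Prop
  | const (k : ℕ) (C : MTm) (n a : ℕ) : MAtm k C n (.const a) (.const a)
  | app (k : ℕ) (C : MTm) (n : ℕ) (P P' : Atm) (M M' : Nor) :
      MAtm k C n P P' → MNor k C n M M' → MAtm k C n (.app P M) (.app P' M')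

inductive MSTy : ℕ → MTm → ℕ → Ty → Ty → Prop
  | atom (k : ℕ) (C : MTm) (n : ℕ) (P P' : Atm) :
      MAtm k C n P P' → MSTy k C n (.atom P) (.atom P')
  | pi (k : ℕ) (C : MTm) (n : ℕ) (A A' B B' : Ty) :
      MSTy k C n A A' → MSTy k C (n + 1) B B' → MSTy k C n (.pi A B) (.pi A' B')
  | arr (k : ℕ) (C : MTm) (n : ℕ) (A A' B B' : Ty) :
      MSTy k C n A A' → MSTy k C n B B' → MSTy k C n (.arr A B) (.arr A' B')

inductive MSCtx : ℕ → MTm → Ctx → Ctx → Prop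
  | nil (k : ℕ) (C : MTm) : MSCtx k C .nil .nil
  | other (k : ℕ) (C : MTm) (p : ℕ) : p ≠ k → MSCtx k C (.cvar p) (.cvar (drop k p))
  | self (k : ℕ) (Φ : Ctx) : MSCtx k (.ctx Φ) (.cvar k) Φ
  | snoc (k : ℕ) (C : MTm) (Ψ Ψ' : Ctx) (h : Status) (A A' : Ty) :
      MSCtx k C Ψ Ψ' → MSTy k C Ψ.len A A' → MSCtx k C (.snoc Ψ h A) (.snoc Ψ' h A')

inductive MSMTy : ℕ → MTm → MTy → MTy → Prop
  | term (k : ℕ) (C : MTm) (Ψ Ψ' : Ctx) (P P' : Atm) :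
      MSCtx k C Ψ Ψ' → MAtm k C Ψ.len P P' → MSMTy k C (.term Ψ P) (.term Ψ' P')
  | schema (k : ℕ) (C : MTm) (G : Schema) : MSMTy k C (.schema G) (.schema G)

/-- `MSCTy k C t t'`: `[[C/X]]t = t'`, where `X` has index `k`. -/
inductive MSCTy : ℕ → MTm → CTy → CTy → Prop
  | box (k : ℕ) (C : MTm) (Ψ Ψ' : Ctx) (P P' : Atm) :
      MSCtx k C Ψ Ψ' → MAtm k C Ψ.len P P' → MSCTy k C (.box Ψ P) (.box Ψ' P')
  | arr (k : ℕ) (C : MTm) (t₁ t₁' t₂ t₂' : CTy) :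
      MSCTy k C t₁ t₁' → MSCTy k C t₂ t₂' → MSCTy k C (.arr t₁ t₂) (.arr t₁' t₂')
  | mpi (k : ℕ) (C : MTm) (U U₁ : MTy) (t t₁ : CTy) :
      MSMTy k C U U₁ → MSCTy (k + 1) (C.mren Nat.succ) t t₁ → MSCTy k C (.mpi U t) (.mpi U₁ t₁)

/-! ### Typing -/

mutual
/-- `Δ; Ψ ⊢ R ⇒ A`. -/
inductive Syn : Sig → MCtx → Ctx → Neu → Ty → Prop
  | var (S : Sig) (Δ : MCtx) (Ψ : Ctx) (i : ℕ) (h : Status) (A : Ty) :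
      Ψ.get i = some (h, A) → Syn S Δ Ψ (.var i) A
  | const (S : Sig) (Δ : MCtx) (Ψ : Ctx) (c : ℕ) (A : Ty) :
      Decl.tmc c A ∈ S → Syn S Δ Ψ (.const c) A
  | appPi (S : Sig) (Δ : MCtx) (Ψ : Ctx) (R : Neu) (M : Nor) (A B B' : Ty) :
      Syn S Δ Ψ R (.pi A B) → Chk S Δ Ψ M A → HTy (Env.one M) B B' → Syn S Δ Ψ (.app R M) B'
  | appArr (S : Sig) (Δ : MCtx) (Ψ : Ctx) (R : Neu) (M : Nor) (A B : Ty) :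
      Syn S Δ Ψ R (.arr A B) → Chk S Δ Ψ M A → Syn S Δ Ψ (.app R M) B
  | mvar (S : Sig) (Δ : MCtx) (Ψ Φ : Ctx) (u : ℕ) (t : Sub) (P P₁ : Atm) :
      Δ.get u = some (.term Φ P) → ChkSub S Δ Ψ t Φ → HAtm t.env P P₁ →
      Syn S Δ Ψ (.mvar u t) (.atom P₁)
/-- `Δ; Ψ ⊢ M ⇐ A`. -/
inductive Chk : Sig → MCtx → Ctx → Nor → Ty → Prop
  | neu (S : Sig) (Δ : MCtx) (Ψ : Ctx) (R : Neu) (P : Atm) :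
      Syn S Δ Ψ R (.atom P) → Chk S Δ Ψ (.neu R) (.atom P)
  | lamPi (S : Sig) (Δ : MCtx) (Ψ : Ctx) (M : Nor) (A B : Ty) :
      Chk S Δ (.snoc Ψ .param A) M B → Chk S Δ Ψ (.lam M) (.pi A B)
  | lamArr (S : Sig) (Δ : MCtx) (Ψ : Ctx) (M : Nor) (A B : Ty) :
      Chk S Δ (.snoc Ψ .proof A) M B.shift → Chk S Δ Ψ (.lam M) (.arr A B)
/-- `Δ; Ψ ⊢ σ ⇐ Φ`. -/
inductive ChkSub : Sig → MCtx → Ctx → Sub → Ctx → Prop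
  | empty (S : Sig) (Δ : MCtx) (Ψ : Ctx) : ChkSub S Δ Ψ .empty .nil
  | wk (S : Sig) (Δ : MCtx) (Ψ : Ctx) (p : ℕ) :
      Ψ.head = some p → ChkSub S Δ Ψ (.wk p) (.cvar p)
  | snoc (S : Sig) (Δ : MCtx) (Ψ Φ : Ctx) (t : Sub) (M : Nor) (h : Status) (B B' : Ty) :
      ChkSub S Δ Ψ t Φ → HTy t.env B B' → Chk S Δ Ψ M B' →
      ChkSub S Δ Ψ (.snoc t M) (.snoc Φ h B)
end

/-- `Δ; Ψ ⊢ P ⇒ K`. -/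
inductive AtmKind : Sig → MCtx → Ctx → Atm → Kind → Prop
  | const (S : Sig) (Δ : MCtx) (Ψ : Ctx) (a : ℕ) (K : Kind) :
      Decl.tyc a K ∈ S → AtmKind S Δ Ψ (.const a) K
  | app (S : Sig) (Δ : MCtx) (Ψ : Ctx) (P : Atm) (M : Nor) (A : Ty) (K K₁ : Kind) :
      AtmKind S Δ Ψ P (.pi A K) → Chk S Δ Ψ M A → HKind (Env.one M) K K₁ →
      AtmKind S Δ Ψ (.app P M) K₁

/-- `Δ; Ψ ⊢ A type`. -/
inductive TyWF : Sig → MCtx → Ctx → Ty → Prop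
  | atom (S : Sig) (Δ : MCtx) (Ψ : Ctx) (P : Atm) :
      AtmKind S Δ Ψ P .type → TyWF S Δ Ψ (.atom P)
  | pi (S : Sig) (Δ : MCtx) (Ψ : Ctx) (A B : Ty) :
      TyWF S Δ Ψ A → TyWF S Δ (.snoc Ψ .param A) B → TyWF S Δ Ψ (.pi A B)
  | arr (S : Sig) (Δ : MCtx) (Ψ : Ctx) (A B : Ty) :
      TyWF S Δ Ψ A → TyWF S Δ Ψ B → TyWF S Δ Ψ (.arr A B)

inductive KindWF : Sig → MCtx → Ctx → Kind → Prop
  | type (S : Sig) (Δ : MCtx) (Ψ : Ctx) : KindWF S Δ Ψ .type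
  | pi (S : Sig) (Δ : MCtx) (Ψ : Ctx) (A : Ty) (K : Kind) :
      TyWF S Δ Ψ A → KindWF S Δ (.snoc Ψ .param A) K → KindWF S Δ Ψ (.pi A K)

/-- Well-formed signatures: every declaration is closed, well-formed over the earlier ones, and
introduces a new name. -/
inductive SigWF : Sig → Prop
  | nil : SigWF []
  | tyc (S : Sig) (a : ℕ) (K : Kind) :
      SigWF S → (∀ K' : Kind, Decl.tyc a K' ∉ S) → KindWF S [] .nil K → SigWF (.tyc a K :: S)
  | tmc (S : Sig) (c : ℕ) (A : Ty) :
      SigWF S → (∀ A' : Ty, Decl.tmc c A' ∉ S) → TyWF S [] .nil A → SigWF (.tmc c A :: S)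

/-- `Δ ⊢ Ψ ctx`. -/
inductive CtxWF : Sig → MCtx → Ctx → Prop
  | nil (S : Sig) (Δ : MCtx) : CtxWF S Δ .nil
  | cvar (S : Sig) (Δ : MCtx) (p : ℕ) (G : Schema) :
      Δ.get p = some (.schema G) → CtxWF S Δ (.cvar p)
  | snoc (S : Sig) (Δ : MCtx) (Ψ : Ctx) (h : Status) (A : Ty) :
      CtxWF S Δ Ψ → TyWF S Δ Ψ A → CtxWF S Δ (.snoc Ψ h A)

/-- Well-formed meta types; schemas are closed. -/
inductive MTyWF : Sig → MCtx → MTy → Prop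
  | term (S : Sig) (Δ : MCtx) (Ψ : Ctx) (P : Atm) :
      CtxWF S Δ Ψ → TyWF S Δ Ψ (.atom P) → MTyWF S Δ (.term Ψ P)
  | schema (S : Sig) (Δ : MCtx) (G : Schema) :
      (∀ (Φ : Ctx) (A : Ty), G.Elem Φ A → CtxWF S [] Φ ∧ TyWF S [] Φ A) → MTyWF S Δ (.schema G)

inductive MCtxWF : Sig → MCtx → Prop
  | nil (S : Sig) : MCtxWF S []
  | cons (S : Sig) (Δ : MCtx) (U : MTy) : MCtxWF S Δ → MTyWF S Δ U → MCtxWF S (U :: Δ)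

/-- `Δ ⊢ τ type`. -/
inductive CTyWF : Sig → MCtx → CTy → Prop
  | box (S : Sig) (Δ : MCtx) (Ψ : Ctx) (P : Atm) :
      CtxWF S Δ Ψ → TyWF S Δ Ψ (.atom P) → CTyWF S Δ (.box Ψ P)
  | arr (S : Sig) (Δ : MCtx) (t₁ t₂ : CTy) :
      CTyWF S Δ t₁ → CTyWF S Δ t₂ → CTyWF S Δ (.arr t₁ t₂)
  | mpi (S : Sig) (Δ : MCtx) (U : MTy) (t : CTy) :
      MTyWF S Δ U → CTyWF S (U :: Δ) t → CTyWF S Δ (.mpi U t)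

/-- `Δ ⊢ Γ ctx`. -/
def CCtxWF (S : Sig) (Δ : MCtx) (Γ : CCtx) : Prop := ∀ t ∈ Γ, CTyWF S Δ t

/-- Schema checking: `Δ ⊩ Ψ ⇐ G`. -/
inductive CtxChk : Sig → MCtx → Ctx → Schema → Prop
  | nil (S : Sig) (Δ : MCtx) (G : Schema) : CtxChk S Δ .nil G
  | cvar (S : Sig) (Δ : MCtx) (p : ℕ) (G : Schema) :
      Δ.get p = some (.schema G) → CtxChk S Δ (.cvar p) G
  | snoc (S : Sig) (Δ : MCtx) (Ψ Φ : Ctx) (h : Status) (A A' : Ty) (G : Schema) (t : Sub) :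
      CtxChk S Δ Ψ G → G.Elem Φ A → ChkSub S Δ Ψ t Φ → HTy t.env A A' →
      CtxChk S Δ (.snoc Ψ h A') G

/-- `Δ ⊩ C ⇐ U`. -/
inductive MChk : Sig → MCtx → MTm → MTy → Prop
  | term (S : Sig) (Δ : MCtx) (Ψ : Ctx) (R : Neu) (P : Atm) :
      Chk S Δ Ψ (.neu R) (.atom P) → MChk S Δ (.term Ψ.erase R) (.term Ψ P)
  | ctx (S : Sig) (Δ : MCtx) (Ψ : Ctx) (G : Schema) :
      CtxChk S Δ Ψ G → MChk S Δ (.ctx Ψ) (.schema G)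

/-! ### The sequent calculus for contextual LF -/

/-- `Assum S Ψ R A`: `R : A` is an assumption that left rules may use, that is, a proof-relevant
declaration of `Ψ` or a declaration of the global signature, to which every sequent has access. -/
inductive Assum : Sig → Ctx → Neu → Ty → Prop
  | var (S : Sig) (Ψ : Ctx) (i : ℕ) (A : Ty) :
      Ψ.get i = some (.proof, A) → Assum S Ψ (.var i) A
  | const (S : Sig) (Ψ : Ctx) (c : ℕ) (A : Ty) : Decl.tmc c A ∈ S → Assum S Ψ (.const c) A

mutual
/-- `Δ; Ψ ⟹ M : A`. -/
inductive LSeq : Sig → MCtx → Ctx → Nor → Ty → Prop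
  | initS (S : Sig) (Δ : MCtx) (Ψ : Ctx) (c : ℕ) (A : Ty) :
      Decl.tmc c A ∈ S → LSeq S Δ Ψ (.neu (.const c)) A
  | initV (S : Sig) (Δ : MCtx) (Ψ : Ctx) (i : ℕ) (A : Ty) :
      Ψ.get i = some (.proof, A) → LSeq S Δ Ψ (.neu (.var i)) A
  | piR (S : Sig) (Δ : MCtx) (Ψ : Ctx) (M : Nor) (A B : Ty) :
      LSeq S Δ (.snoc Ψ .param A) M B → LSeq S Δ Ψ (.lam M) (.pi A B)
  | piL (S : Sig) (Δ : MCtx) (Ψ : Ctx) (R : Neu) (M N N' : Nor) (A B B' A' : Ty) :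
      Assum S Ψ R (.pi A B) → Chk S Δ Ψ M A → HTy (Env.one M) B B' →
      LSeq S Δ (.snoc Ψ .proof B') N A'.shift → HNor (Env.one (.neu (.app R M))) N N' →
      LSeq S Δ Ψ N' A'
  | arrR (S : Sig) (Δ : MCtx) (Ψ : Ctx) (M : Nor) (A B : Ty) :
      LSeq S Δ (.snoc Ψ .proof A) M B.shift → LSeq S Δ Ψ (.lam M) (.arr A B)
  | arrL (S : Sig) (Δ : MCtx) (Ψ : Ctx) (R : Neu) (M N N' : Nor) (A B A' : Ty) :
      Assum S Ψ R (.arr A B) → LSeq S Δ Ψ M A →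
      LSeq S Δ (.snoc Ψ .proof B) N A'.shift → HNor (Env.one (.neu (.app R M))) N N' →
      LSeq S Δ Ψ N' A'
  | reflect (S : Sig) (Δ : MCtx) (Ψ Φ : Ctx) (u : ℕ) (t : Sub) (P P' : Atm) (M M' : Nor)
      (A : Ty) :
      Δ.get u = some (.term Φ P) → LSeqSub S Δ Ψ t Φ → HAtm t.env P P' →
      LSeq S Δ (.snoc Ψ .proof (.atom P')) M A.shift → HNor (Env.one (.neu (.mvar u t))) M M' →
      LSeq S Δ Ψ M' A
/-- `Δ; Ψ ⟹ σ : Φ`. -/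
inductive LSeqSub : Sig → MCtx → Ctx → Sub → Ctx → Prop
  | empty (S : Sig) (Δ : MCtx) (Ψ : Ctx) : LSeqSub S Δ Ψ .empty .nil
  | wk (S : Sig) (Δ : MCtx) (Ψ : Ctx) (p : ℕ) :
      Ψ.head = some p → LSeqSub S Δ Ψ (.wk p) (.cvar p)
  | subP (S : Sig) (Δ : MCtx) (Ψ Φ : Ctx) (t : Sub) (N : Nor) (B B' : Ty) :
      LSeqSub S Δ Ψ t Φ → HTy t.env B B' → LSeq S Δ Ψ N B' →
      LSeqSub S Δ Ψ (.snoc t N) (.snoc Φ .proof B)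
  | subU (S : Sig) (Δ : MCtx) (Ψ Φ : Ctx) (t : Sub) (M : Nor) (B B' : Ty) :
      LSeqSub S Δ Ψ t Φ → HTy t.env B B' → Chk S Δ Ψ M B' →
      LSeqSub S Δ Ψ (.snoc t M) (.snoc Φ .param B)
end

/-! ### The sequent calculus for the computation logic -/

/-- `Δ; Γ ⟹ E : τ`. -/
inductive CSeq : Sig → MCtx → CCtx → Exp → CTy → Prop
  | init (S : Sig) (Δ : MCtx) (Γ : CCtx) (y : ℕ) (t : CTy) :
      Γ[y]? = some t → CSeq S Δ Γ (.var y) t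
  | mpiR (S : Sig) (Δ : MCtx) (Γ : CCtx) (U : MTy) (E : Exp) (t : CTy) :
      CSeq S (U :: Δ) Γ.mshift E t → CSeq S Δ Γ (.mlam E) (.mpi U t)
  | mpiL (S : Sig) (Δ : MCtx) (Γ : CCtx) (y : ℕ) (U : MTy) (C : MTm) (E : Exp) (t₁ t₁' t : CTy) :
      Γ[y]? = some (.mpi U t₁) → MChk S Δ C U → MSCTy 0 C t₁ t₁' →
      CSeq S Δ (t₁' :: Γ) E t → CSeq S Δ Γ (E.inst (.mapp (.var y) C)) t
  | arrL (S : Sig) (Δ : MCtx) (Γ : CCtx) (y : ℕ) (E' E : Exp) (t₁ t₂ t : CTy) :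
      Γ[y]? = some (.arr t₁ t₂) → CSeq S Δ Γ E' t₁ →
      CSeq S Δ (t₂ :: Γ) E t → CSeq S Δ Γ (E.inst (.app (.var y) E')) t
  | arrR (S : Sig) (Δ : MCtx) (Γ : CCtx) (E : Exp) (t₁ t₂ : CTy) :
      CSeq S Δ (t₁ :: Γ) E t₂ → CSeq S Δ Γ (.fn E) (.arr t₁ t₂)
  | boxR (S : Sig) (Δ : MCtx) (Γ : CCtx) (Ψ : Ctx) (R : Neu) (P : Atm) :
      LSeq S Δ Ψ (.neu R) (.atom P) → CSeq S Δ Γ (.box Ψ.erase R) (.box Ψ P)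
  | boxL (S : Sig) (Δ : MCtx) (Γ : CCtx) (y : ℕ) (Ψ : Ctx) (P : Atm) (E : Exp) (t : CTy) :
      Γ[y]? = some (.box Ψ P) → CSeq S (.term Ψ P :: Δ) Γ.mshift E t.mshift →
      CSeq S Δ Γ (.letbox (.var y) E) t

/-! ### Sequents without proof terms -/

/-- `Δ; Ψ ⟹ A` is derivable. -/
def LFDerivable (S : Sig) (Δ : MCtx) (Ψ : Ctx) (A : Ty) : Prop := ∃ M : Nor, LSeq S Δ Ψ M A

/-- `Δ; Γ ⟹ τ` is derivable. -/
def CompDerivable (S : Sig) (Δ : MCtx) (Γ : CCtx) (t : CTy) : Prop := ∃ E : Exp, CSeq S Δ Γ E t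

/-- The sequent `Δ; Ψ ⟹ A` is well-formed. -/
structure LFSequentWF (S : Sig) (Δ : MCtx) (Ψ : Ctx) (A : Ty) : Prop where
  mctx : MCtxWF S Δ
  ctx : CtxWF S Δ Ψ
  goal : TyWF S Δ Ψ A

/-- The sequent `Δ; Γ ⟹ τ` is well-formed. -/
structure CompSequentWF (S : Sig) (Δ : MCtx) (Γ : CCtx) (t : CTy) : Prop where
  mctx : MCtxWF S Δ
  ctx : CCtxWF S Δ Γ
  goal : CTyWF S Δ t

end Beluga

namespace Beluga

/-! ### Renamings of kinds and algebra of renamings -/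

-- Each right rule is inverted by induction on the derivation. If the right rule comes last, its
-- premise is the claim. If a left rule comes last, the induction hypothesis is applied to the
-- premise that carries the same succedent, the two new declarations are exchanged where they land
-- in the same context, and the left rule is repeated with weakened side premises
-- (`LSeq.right_premise`, `CSeq.arr_premise`, `CSeq.mpi_premise`). Weakening and exchange are
-- instances of the stability of derivability under renamings (`LSeq.ren`, `LSeq.mren`, `CSeq.mono`,
-- `CSeq.mren`). An LF left rule also requires that the substitution in its proof term be defined;
-- it is, because a neutral term is substituted and no redex arises (`Env.Neutral.exists_nor`).
--
-- The substantial case is init, which is not restricted to atomic types. There the assumption has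
-- the very type to be inverted, and it is applied to the newly declared variable. For implications
-- two uses of init suffice. For `Πx̂:A.B` the argument has to be a long normal form `η(x)`, and one
-- needs that `η(x)` checks against `A` and that `[η(x)/x]B = B`. For `Π□X:U.τ` the argument is `X`
-- in long form, namely `X[id_Ψ]` or a context variable, and one needs `[[X/X]]τ = τ`. Hereditary
-- substitution contracts redexes, so these identity laws (`TyWF.one_etaExp`, `CTyWF.meta_id`) are
-- not immediate. They rest on `etaSubst`, an induction on simple types: forgetting dependencies in
-- LF types loses nothing that matters for the contractions.
--
-- Inverting `□L` is weakening by `X`, since the assumption `y` is kept. Renaming a computation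
-- derivation requires that the schemas in it be closed, an invariant that is carried along in place
-- of well-formedness of the contexts.

def Kind.ren : (ℕ → ℕ) → Kind → Kind
  | _, .type => .type
  | r, .pi A K => .pi (A.ren r) (K.ren (up r))

def Kind.mren (r : ℕ → ℕ) : Kind → Kind
  | .type => .type
  | .pi A K => .pi (A.mren r) (K.mren r)

attribute [simp] Neu.ren Nor.ren Sub.ren Atm.ren Ty.ren Kind.ren Neu.mren Nor.mren Sub.mren
  Atm.mren Ty.mren Kind.mren Ctx.mren CTy.mren

@[simp] theorem MTy.mren_term (r : ℕ → ℕ) (Ψ : Ctx) (P : Atm) :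
    (MTy.term Ψ P).mren r = .term (Ψ.mren r) (P.mren r) := rfl

@[simp] theorem MTy.mren_schema (r : ℕ → ℕ) (G : Schema) :
    (MTy.schema G).mren r = .schema G := rfl

@[simp] theorem MTm.mren_term (r : ℕ → ℕ) (e : ECtx) (R : Neu) :
    (MTm.term e R).mren r = .term (e.mren r) (R.mren r) := rfl

@[simp] theorem MTm.mren_ctx (r : ℕ → ℕ) (Ψ : Ctx) :
    (MTm.ctx Ψ).mren r = .ctx (Ψ.mren r) := rfl

@[simp] theorem up_zero (r : ℕ → ℕ) : up r 0 = 0 := rfl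

@[simp] theorem up_succ (r : ℕ → ℕ) (i : ℕ) : up r (i + 1) = r i + 1 := rfl

theorem up_comp (r q : ℕ → ℕ) : up (q ∘ r) = up q ∘ up r := by
  funext i; cases i <;> rfl

theorem up_id : up id = id := by
  funext i; cases i <;> rfl

theorem up_comp_succ (r : ℕ → ℕ) : up r ∘ Nat.succ = Nat.succ ∘ r := rfl

mutual
theorem Neu.ren_ren (r q : ℕ → ℕ) : ∀ R : Neu, (R.ren r).ren q = R.ren (q ∘ r)
  | .var _ => rfl
  | .const _ => rfl
  | .app R N => by simp [R.ren_ren r q, N.ren_ren r q]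
  | .mvar _ t => by simp [t.ren_ren r q]
theorem Nor.ren_ren (r q : ℕ → ℕ) : ∀ M : Nor, (M.ren r).ren q = M.ren (q ∘ r)
  | .neu R => by simp [R.ren_ren r q]
  | .lam M => by simp [M.ren_ren (up r) (up q), up_comp]
theorem Sub.ren_ren (r q : ℕ → ℕ) : ∀ t : Sub, (t.ren r).ren q = t.ren (q ∘ r)
  | .empty => rfl
  | .wk _ => rfl
  | .snoc t M => by simp [t.ren_ren r q, M.ren_ren r q]
end

theorem Atm.ren_ren (r q : ℕ → ℕ) : ∀ P : Atm, (P.ren r).ren q = P.ren (q ∘ r)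
  | .const _ => rfl
  | .app P M => by simp [P.ren_ren r q, M.ren_ren]

theorem Ty.ren_ren : ∀ (A : Ty) (r q : ℕ → ℕ), (A.ren r).ren q = A.ren (q ∘ r)
  | .atom P, r, q => by simp [P.ren_ren]
  | .pi A B, r, q => by simp [A.ren_ren, B.ren_ren, up_comp]
  | .arr A B, r, q => by simp [A.ren_ren, B.ren_ren]

mutual
theorem Neu.ren_id : ∀ R : Neu, R.ren id = R
  | .var _ => rfl
  | .const _ => rfl
  | .app R N => by simp [R.ren_id, N.ren_id]
  | .mvar _ t => by simp [t.ren_id]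
theorem Nor.ren_id : ∀ M : Nor, M.ren id = M
  | .neu R => by simp [R.ren_id]
  | .lam M => by simp [up_id, M.ren_id]
theorem Sub.ren_id : ∀ t : Sub, t.ren id = t
  | .empty => rfl
  | .wk _ => rfl
  | .snoc t M => by simp [t.ren_id, M.ren_id]
end

theorem Atm.ren_id : ∀ P : Atm, P.ren id = P
  | .const _ => rfl
  | .app P M => by simp [P.ren_id, M.ren_id]

theorem Ty.ren_id : ∀ A : Ty, A.ren id = A
  | .atom P => by simp [P.ren_id]
  | .pi A B => by simp [A.ren_id, up_id, B.ren_id]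
  | .arr A B => by simp [A.ren_id, B.ren_id]

-- Algebra of contextual renamings.

mutual
theorem Neu.mren_mren (r q : ℕ → ℕ) : ∀ R : Neu, (R.mren r).mren q = R.mren (q ∘ r)
  | .var _ => rfl
  | .const _ => rfl
  | .app R N => by simp [R.mren_mren r q, N.mren_mren r q]
  | .mvar _ t => by simp [t.mren_mren r q]
theorem Nor.mren_mren (r q : ℕ → ℕ) : ∀ M : Nor, (M.mren r).mren q = M.mren (q ∘ r)
  | .neu R => by simp [R.mren_mren r q]
  | .lam M => by simp [M.mren_mren r q]
theorem Sub.mren_mren (r q : ℕ → ℕ) : ∀ t : Sub, (t.mren r).mren q = t.mren (q ∘ r)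
  | .empty => rfl
  | .wk _ => rfl
  | .snoc t M => by simp [t.mren_mren r q, M.mren_mren r q]
end

theorem Atm.mren_mren (r q : ℕ → ℕ) : ∀ P : Atm, (P.mren r).mren q = P.mren (q ∘ r)
  | .const _ => rfl
  | .app P M => by simp [P.mren_mren r q, M.mren_mren]

theorem Ty.mren_mren (r q : ℕ → ℕ) : ∀ A : Ty, (A.mren r).mren q = A.mren (q ∘ r)
  | .atom P => by simp [P.mren_mren]
  | .pi A B => by simp [A.mren_mren, B.mren_mren]
  | .arr A B => by simp [A.mren_mren, B.mren_mren]

theorem Ctx.mren_mren (r q : ℕ → ℕ) : ∀ Ψ : Ctx, (Ψ.mren r).mren q = Ψ.mren (q ∘ r)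
  | .nil => rfl
  | .cvar _ => rfl
  | .snoc Ψ h A => by simp [Ψ.mren_mren, A.mren_mren]

theorem MTy.mren_mren (r q : ℕ → ℕ) : ∀ U : MTy, (U.mren r).mren q = U.mren (q ∘ r)
  | .term Ψ P => by simp [Ψ.mren_mren, P.mren_mren]
  | .schema G => rfl

theorem MTm.mren_mren (r q : ℕ → ℕ) : ∀ C : MTm, (C.mren r).mren q = C.mren (q ∘ r)
  | .term e R => by simp [R.mren_mren, ECtx.mren]
  | .ctx Ψ => by simp [Ψ.mren_mren]

theorem CTy.mren_mren : ∀ (t : CTy) (r q : ℕ → ℕ), (t.mren r).mren q = t.mren (q ∘ r)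
  | .box Ψ P, r, q => by simp [Ψ.mren_mren, P.mren_mren]
  | .arr t₁ t₂, r, q => by simp [t₁.mren_mren, t₂.mren_mren]
  | .mpi U t, r, q => by simp [U.mren_mren, t.mren_mren, up_comp]

mutual
theorem Neu.mren_ren (q : ℕ → ℕ) :
    ∀ (R : Neu) (r : ℕ → ℕ), (R.ren r).mren q = (R.mren q).ren r
  | .var _, _ => rfl
  | .const _, _ => rfl
  | .app R N, r => by simp [R.mren_ren q r, N.mren_ren q r]
  | .mvar _ t, r => by simp [t.mren_ren q r]
theorem Nor.mren_ren (q : ℕ → ℕ) :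
    ∀ (M : Nor) (r : ℕ → ℕ), (M.ren r).mren q = (M.mren q).ren r
  | .neu R, r => by simp [R.mren_ren q r]
  | .lam M, r => by simp [M.mren_ren q (up r)]
theorem Sub.mren_ren (q : ℕ → ℕ) :
    ∀ (t : Sub) (r : ℕ → ℕ), (t.ren r).mren q = (t.mren q).ren r
  | .empty, _ => rfl
  | .wk _, _ => rfl
  | .snoc t M, r => by simp [t.mren_ren q r, M.mren_ren q r]
end

theorem Atm.mren_ren (q r : ℕ → ℕ) : ∀ P : Atm, (P.ren r).mren q = (P.mren q).ren r
  | .const _ => rfl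
  | .app P M => by simp [P.mren_ren q r, M.mren_ren]

theorem Ty.mren_ren (q : ℕ → ℕ) :
    ∀ (A : Ty) (r : ℕ → ℕ), (A.ren r).mren q = (A.mren q).ren r
  | .atom P, r => by simp [P.mren_ren]
  | .pi A B, r => by simp [A.mren_ren q, B.mren_ren q]
  | .arr A B, r => by simp [A.mren_ren q, B.mren_ren q]

theorem Ty.shift_ren (A : Ty) (r : ℕ → ℕ) : A.shift.ren (up r) = (A.ren r).shift := by
  simp [Ty.shift, Ty.ren_ren, up_comp_succ]

theorem Ty.shift_mren (A : Ty) (q : ℕ → ℕ) : A.shift.mren q = (A.mren q).shift :=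
  A.mren_ren q _

theorem CTy.mshift_mren (t : CTy) (q : ℕ → ℕ) : t.mshift.mren (up q) = (t.mren q).mshift := by
  simp [CTy.mshift, CTy.mren_mren, up_comp_succ]

theorem MTm.mshift_mren (C : MTm) (q : ℕ → ℕ) :
    (C.mren Nat.succ).mren (up q) = (C.mren q).mren Nat.succ := by
  simp [MTm.mren_mren, up_comp_succ]

theorem CCtx.mshift_mren (Γ : CCtx) (q : ℕ → ℕ) :
    Γ.mshift.map (CTy.mren (up q)) = CCtx.mshift (Γ.map (CTy.mren q)) := by
  simp [CCtx.mshift, CTy.mshift_mren]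

/-! ### Renaming in hereditary substitution -/

theorem Env.up_ren {s s' : Env} {r q : ℕ → ℕ}
    (h : ∀ i M, s i = some M → s' (r i) = some (M.ren q)) (i : ℕ) (M : Nor)
    (hi : s.up i = some M) : s'.up (Beluga.up r i) = some (M.ren (Beluga.up q)) := by
  cases i with
  | zero => cases hi; rfl
  | succ i =>
    simp only [Env.up, Option.map_eq_some_iff] at hi
    obtain ⟨N, hN, rfl⟩ := hi
    simp [Env.up, h i N hN, Nor.ren_ren, up_comp_succ]

theorem Env.one_ren (N : Nor) (r : ℕ → ℕ) (i : ℕ) (M : Nor) (hi : Env.one N i = some M) :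
    Env.one (N.ren r) (Beluga.up r i) = some (M.ren r) := by
  cases i <;> cases hi <;> rfl

theorem Sub.env_ren (r : ℕ → ℕ) : ∀ (t : Sub) (i : ℕ) (M : Nor), t.env i = some M →
    (t.ren r).env i = some (M.ren r)
  | .snoc t N, 0, M, h => by cases h; rfl
  | .snoc t N, i + 1, M, h => Sub.env_ren r t i M h

mutual
-- The source variables are renamed by `r` and the resulting terms by an independent `q`. In a beta
-- step the body has one variable more than the result, so `r = up q`; elsewhere `r` or `q` is the
-- identity.
theorem HNeu.ren : ∀ {s : Env} {R : Neu} {M : Nor}, HNeu s R M → ∀ {s' : Env} {r q : ℕ → ℕ},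
    (∀ i M, s i = some M → s' (r i) = some (M.ren q)) → HNeu s' (R.ren r) (M.ren q)
  | _, _, _, .var _ i M h, _, _, _, hs => .var _ _ _ (hs i M h)
  | _, _, _, .const _ _, _, _, _, _ => .const _ _
  | _, _, _, .app _ _ _ _ _ _ h₁ h₂ h₃, _, _, _, hs =>
    .app _ _ _ _ _ _ (h₁.ren hs) (h₂.ren hs) (h₃.ren _)
  | _, _, _, .mvar _ _ _ _ h, _, _, _, hs => .mvar _ _ _ _ (h.ren hs)
theorem HNor.ren : ∀ {s : Env} {M M' : Nor}, HNor s M M' → ∀ {s' : Env} {r q : ℕ → ℕ},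
    (∀ i M, s i = some M → s' (r i) = some (M.ren q)) → HNor s' (M.ren r) (M'.ren q)
  | _, _, _, .neu _ _ _ h, _, _, _, hs => .neu _ _ _ (h.ren hs)
  | _, _, _, .lam _ _ _ h, _, _, _, hs => .lam _ _ _ (h.ren (Env.up_ren hs))
theorem HApp.ren : ∀ {M N M' : Nor}, HApp M N M' → ∀ q : ℕ → ℕ,
    HApp (M.ren q) (N.ren q) (M'.ren q)
  | _, _, _, .neu _ _, _ => .neu _ _
  | _, _, _, .beta _ N _ h, q => .beta _ _ _ (h.ren (Env.one_ren N q))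
theorem HSub.ren : ∀ {s : Env} {t t' : Sub}, HSub s t t' → ∀ {s' : Env} {r q : ℕ → ℕ},
    (∀ i M, s i = some M → s' (r i) = some (M.ren q)) → HSub s' (t.ren r) (t'.ren q)
  | _, _, _, .empty _, _, _, _, _ => .empty _
  | _, _, _, .wk _ _, _, _, _, _ => .wk _ _
  | _, _, _, .snoc _ _ _ _ _ h₁ h₂, _, _, _, hs => .snoc _ _ _ _ _ (h₁.ren hs) (h₂.ren hs)
end

theorem HAtm.ren {s s' : Env} {P P' : Atm} {r q : ℕ → ℕ} (h : HAtm s P P')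
    (hs : ∀ i M, s i = some M → s' (r i) = some (M.ren q)) :
    HAtm s' (P.ren r) (P'.ren q) := by
  induction h with
  | const => exact .const _ _
  | app _ _ _ _ _ h ih => exact .app _ _ _ _ _ ih (h.ren hs)

theorem HTy.ren {s : Env} {A A' : Ty} (h : HTy s A A') : ∀ {s' : Env} {r q : ℕ → ℕ},
    (∀ i M, s i = some M → s' (r i) = some (M.ren q)) → HTy s' (A.ren r) (A'.ren q) := by
  induction h with
  | atom _ _ _ h => exact fun hs => .atom _ _ _ (h.ren hs)
  | pi _ _ _ _ _ _ _ ih₁ ih₂ => exact fun hs => .pi _ _ _ _ _ (ih₁ hs) (ih₂ (Env.up_ren hs))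
  | arr _ _ _ _ _ _ _ ih₁ ih₂ => exact fun hs => .arr _ _ _ _ _ (ih₁ hs) (ih₂ hs)

/-- The case for `[σ]P` with `P` over the domain `Φ` of `σ`: renaming the ambient context `Ψ`
affects the entries of `σ` and the result, but not `P`. -/
theorem HAtm.ren_result {s s' : Env} {P P' : Atm} {q : ℕ → ℕ} (h : HAtm s P P')
    (hs : ∀ i M, s i = some M → s' i = some (M.ren q)) : HAtm s' P (P'.ren q) :=
  P.ren_id ▸ h.ren (r := id) hs

theorem HTy.ren_result {s s' : Env} {A A' : Ty} {q : ℕ → ℕ} (h : HTy s A A')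
    (hs : ∀ i M, s i = some M → s' i = some (M.ren q)) : HTy s' A (A'.ren q) :=
  A.ren_id ▸ h.ren (r := id) hs

theorem HKind.ren {s : Env} {K K' : Kind} (h : HKind s K K') : ∀ {s' : Env} {r q : ℕ → ℕ},
    (∀ i M, s i = some M → s' (r i) = some (M.ren q)) → HKind s' (K.ren r) (K'.ren q) := by
  induction h with
  | type => exact fun _ => .type _
  | pi _ _ _ _ _ h _ ih => exact fun hs => .pi _ _ _ _ _ (h.ren hs) (ih (Env.up_ren hs))

-- Contextual renamings in hereditary substitution.

theorem Env.up_mren {s s' : Env} {q : ℕ → ℕ}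
    (h : ∀ i M, s i = some M → s' i = some (M.mren q)) (i : ℕ) (M : Nor)
    (hi : s.up i = some M) : s'.up i = some (M.mren q) := by
  cases i with
  | zero => cases hi; rfl
  | succ i =>
    simp only [Env.up, Option.map_eq_some_iff] at hi
    obtain ⟨N, hN, rfl⟩ := hi
    simp [Env.up, h i N hN, Nor.mren_ren]

theorem Env.one_mren (N : Nor) (q : ℕ → ℕ) (i : ℕ) (M : Nor) (hi : Env.one N i = some M) :
    Env.one (N.mren q) i = some (M.mren q) := by
  cases i <;> cases hi <;> rfl

theorem Sub.env_mren (q : ℕ → ℕ) : ∀ (t : Sub) (i : ℕ) (M : Nor), t.env i = some M →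
    (t.mren q).env i = some (M.mren q)
  | .snoc t N, 0, M, h => by cases h; rfl
  | .snoc t N, i + 1, M, h => Sub.env_mren q t i M h

mutual
theorem HNeu.mren : ∀ {s : Env} {R : Neu} {M : Nor}, HNeu s R M → ∀ {s' : Env} {q : ℕ → ℕ},
    (∀ i M, s i = some M → s' i = some (M.mren q)) → HNeu s' (R.mren q) (M.mren q)
  | _, _, _, .var _ i M h, _, _, hs => .var _ _ _ (hs i M h)
  | _, _, _, .const _ _, _, _, _ => .const _ _
  | _, _, _, .app _ _ _ _ _ _ h₁ h₂ h₃, _, _, hs =>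
    .app _ _ _ _ _ _ (h₁.mren hs) (h₂.mren hs) (h₃.mren _)
  | _, _, _, .mvar _ _ _ _ h, _, _, hs => .mvar _ _ _ _ (h.mren hs)
theorem HNor.mren : ∀ {s : Env} {M M' : Nor}, HNor s M M' → ∀ {s' : Env} {q : ℕ → ℕ},
    (∀ i M, s i = some M → s' i = some (M.mren q)) → HNor s' (M.mren q) (M'.mren q)
  | _, _, _, .neu _ _ _ h, _, _, hs => .neu _ _ _ (h.mren hs)
  | _, _, _, .lam _ _ _ h, _, _, hs => .lam _ _ _ (h.mren (Env.up_mren hs))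
theorem HApp.mren : ∀ {M N M' : Nor}, HApp M N M' → ∀ q : ℕ → ℕ,
    HApp (M.mren q) (N.mren q) (M'.mren q)
  | _, _, _, .neu _ _, _ => .neu _ _
  | _, _, _, .beta _ N _ h, q => .beta _ _ _ (h.mren (Env.one_mren N q))
theorem HSub.mren : ∀ {s : Env} {t t' : Sub}, HSub s t t' → ∀ {s' : Env} {q : ℕ → ℕ},
    (∀ i M, s i = some M → s' i = some (M.mren q)) → HSub s' (t.mren q) (t'.mren q)
  | _, _, _, .empty _, _, _, _ => .empty _
  | _, _, _, .wk _ _, _, _, _ => .wk _ _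
  | _, _, _, .snoc _ _ _ _ _ h₁ h₂, _, _, hs => .snoc _ _ _ _ _ (h₁.mren hs) (h₂.mren hs)
end

theorem HAtm.mren {s s' : Env} {P P' : Atm} {q : ℕ → ℕ} (h : HAtm s P P')
    (hs : ∀ i M, s i = some M → s' i = some (M.mren q)) :
    HAtm s' (P.mren q) (P'.mren q) := by
  induction h with
  | const => exact .const _ _
  | app _ _ _ _ _ h ih => exact .app _ _ _ _ _ ih (h.mren hs)

theorem HTy.mren {s : Env} {A A' : Ty} (h : HTy s A A') : ∀ {s' : Env} {q : ℕ → ℕ},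
    (∀ i M, s i = some M → s' i = some (M.mren q)) → HTy s' (A.mren q) (A'.mren q) := by
  induction h with
  | atom _ _ _ h => exact fun hs => .atom _ _ _ (h.mren hs)
  | pi _ _ _ _ _ _ _ ih₁ ih₂ => exact fun hs => .pi _ _ _ _ _ (ih₁ hs) (ih₂ (Env.up_mren hs))
  | arr _ _ _ _ _ _ _ ih₁ ih₂ => exact fun hs => .arr _ _ _ _ _ (ih₁ hs) (ih₂ hs)

theorem HKind.mren {s : Env} {K K' : Kind} (h : HKind s K K') : ∀ {s' : Env} {q : ℕ → ℕ},
    (∀ i M, s i = some M → s' i = some (M.mren q)) → HKind s' (K.mren q) (K'.mren q) := by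
  induction h with
  | type => exact fun _ => .type _
  | pi _ _ _ _ _ h _ ih => exact fun hs => .pi _ _ _ _ _ (h.mren hs) (ih (Env.up_mren hs))

/-! ### Substitution of neutral terms -/

/-- A total environment of neutral terms. -/
def Env.Neutral (s : Env) : Prop := ∀ i, ∃ R, s i = some (.neu R)

theorem Env.Neutral.up {s : Env} (h : s.Neutral) : s.up.Neutral
  | 0 => ⟨_, rfl⟩
  | i + 1 => by
    obtain ⟨R, hR⟩ := h i
    exact ⟨R.ren Nat.succ, by simp [Env.up, hR]⟩

theorem Env.neutral_one (R : Neu) : (Env.one (.neu R)).Neutral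
  | 0 => ⟨_, rfl⟩
  | _ + 1 => ⟨_, rfl⟩

mutual
-- Hereditary substitution can only fail at an unmapped variable or in contracting a redex. Here
-- every variable is mapped, and a neutral head stays neutral, so no redex appears.
theorem Env.Neutral.exists_neu : ∀ (R : Neu) {s : Env}, s.Neutral → ∃ R', HNeu s R (.neu R')
  | .var i, _, h => (h i).imp fun _ h => .var _ _ _ h
  | .const _, _, _ => ⟨_, .const _ _⟩
  | .app R N, _, h =>
    let ⟨_, hR⟩ := h.exists_neu R
    let ⟨_, hN⟩ := h.exists_nor N
    ⟨_, .app _ _ _ _ _ _ hR hN (.neu _ _)⟩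
  | .mvar _ t, _, h => let ⟨_, ht⟩ := h.exists_sub t; ⟨_, .mvar _ _ _ _ ht⟩
theorem Env.Neutral.exists_nor : ∀ (M : Nor) {s : Env}, s.Neutral → ∃ M', HNor s M M'
  | .neu R, _, h => let ⟨_, hR⟩ := h.exists_neu R; ⟨_, .neu _ _ _ hR⟩
  | .lam M, _, h => let ⟨_, hM⟩ := h.up.exists_nor M; ⟨_, .lam _ _ _ hM⟩
theorem Env.Neutral.exists_sub : ∀ (t : Sub) {s : Env}, s.Neutral → ∃ t', HSub s t t'
  | .empty, _, _ => ⟨_, .empty _⟩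
  | .wk _, _, _ => ⟨_, .wk _ _⟩
  | .snoc t M, _, h =>
    let ⟨_, ht⟩ := h.exists_sub t
    let ⟨_, hM⟩ := h.exists_nor M
    ⟨_, .snoc _ _ _ _ _ ht hM⟩
end

/-! ### Renamings between contexts -/

/-- `r` is a renaming from `Ψ` to `Ψ'`. -/
structure CtxRen (r : ℕ → ℕ) (Ψ Ψ' : Ctx) : Prop where
  get : ∀ i d, Ψ.get i = some d → Ψ'.get (r i) = some (d.1, d.2.ren r)
  head : ∀ p, Ψ.head = some p → Ψ'.head = some p

theorem Ctx.get_succ (Ψ : Ctx) (h : Status) (A : Ty) (i : ℕ) :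
    (Ctx.snoc Ψ h A).get (i + 1) = (Ψ.get i).map fun d => (d.1, d.2.shift) := rfl

theorem CtxRen.up {r : ℕ → ℕ} {Ψ Ψ' : Ctx} (hr : CtxRen r Ψ Ψ') (h : Status) (A : Ty) :
    CtxRen (up r) (.snoc Ψ h A) (.snoc Ψ' h (A.ren r)) where
  get i d hd := by
    cases i with
    | zero => cases hd; simp [Ctx.get, Ty.shift_ren]
    | succ i =>
      simp only [Ctx.get, Option.map_eq_some_iff] at hd
      obtain ⟨e, he, rfl⟩ := hd
      simp [Ctx.get, hr.get i e he, Ty.shift_ren]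
  head := hr.head

theorem CtxRen.succ (Ψ : Ctx) (h : Status) (A : Ty) :
    CtxRen Nat.succ Ψ (.snoc Ψ h A) where
  get i d hd := by simp [Ctx.get, hd, Ty.shift]
  head _ := id

/-- The renaming that exchanges the indices `0` and `1`. -/
def swap : ℕ → ℕ
  | 0 => 1
  | 1 => 0
  | i + 2 => i + 2

theorem swap_comp_up_succ : swap ∘ up Nat.succ = Nat.succ := by
  funext i; cases i <;> rfl

theorem swap_comp_succ_succ : swap ∘ Nat.succ ∘ Nat.succ = Nat.succ ∘ Nat.succ := rfl

/-- Both types come from `Ψ`, so neither declaration depends on the other; this is what makes the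
exchange possible. -/
theorem CtxRen.swap (Ψ : Ctx) (h h' : Status) (A B : Ty) :
    CtxRen swap (.snoc (.snoc Ψ h A) h' B.shift) (.snoc (.snoc Ψ h' B) h A.shift) where
  get i d hd := by
    match i with
    | 0 =>
      cases hd
      simp [Ctx.get, Beluga.swap, Ty.shift, Ty.ren_ren, swap_comp_succ_succ]
    | 1 =>
      cases hd
      simp [Ctx.get, Beluga.swap, Ty.shift, Ty.ren_ren, swap_comp_succ_succ]
    | i + 2 =>
      simp only [Ctx.get, Option.map_eq_some_iff] at hd
      obtain ⟨e, ⟨f, hf, rfl⟩, rfl⟩ := hd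
      simp [Ctx.get, Beluga.swap, hf, Ty.shift, Ty.ren_ren, swap_comp_succ_succ]
  head _ := id

/-- `q` is a renaming from `Δ` to `Δ'`. -/
def MCtxRen (q : ℕ → ℕ) (Δ Δ' : MCtx) : Prop :=
  ∀ i U, Δ.get i = some U → Δ'.get (q i) = some (U.mren q)

theorem MCtx.get_zero (Δ : MCtx) (U : MTy) :
    MCtx.get (U :: Δ) 0 = some (U.mren Nat.succ) := rfl

theorem MCtx.get_succ (Δ : MCtx) (U : MTy) (i : ℕ) :
    MCtx.get (U :: Δ) (i + 1) = (Δ.get i).map (MTy.mren Nat.succ) := by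
  simp only [MCtx.get, List.getElem?_cons_succ, Option.map_map]
  congr 1
  funext V
  simp only [Function.comp, MTy.mren_mren]
  rfl

theorem MCtxRen.up {q : ℕ → ℕ} {Δ Δ' : MCtx} (hq : MCtxRen q Δ Δ') (U : MTy) :
    MCtxRen (up q) (U :: Δ) (U.mren q :: Δ') := by
  intro i V hV
  cases i with
  | zero =>
    cases hV
    simp [MCtx.get_zero, MTy.mren_mren]
    rfl
  | succ i =>
    simp only [MCtx.get_succ, Option.map_eq_some_iff] at hV
    obtain ⟨W, hW, rfl⟩ := hV
    simp [MCtx.get_succ, hq i W hW, MTy.mren_mren, up_comp_succ]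

theorem MCtxRen.succ (Δ : MCtx) (U : MTy) : MCtxRen Nat.succ Δ (U :: Δ) := by
  intro i V hV
  simp [MCtx.get_succ, hV]

theorem MCtxRen.swap (Δ : MCtx) (U V : MTy) :
    MCtxRen swap (V.mren Nat.succ :: U :: Δ) (U.mren Nat.succ :: V :: Δ) := by
  intro i W hW
  match i with
  | 0 =>
    cases hW
    simp only [Beluga.swap, MCtx.get_succ, MCtx.get_zero, Option.map_some, MTy.mren_mren]
    rfl
  | 1 =>
    simp only [MCtx.get_succ, MCtx.get_zero, Option.map_some, Option.some.injEq] at hW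
    subst hW
    simp only [Beluga.swap, MCtx.get_zero, MTy.mren_mren]
    rfl
  | i + 2 =>
    simp only [MCtx.get_succ, Option.map_eq_some_iff] at hW
    obtain ⟨_, ⟨W, hW, rfl⟩, rfl⟩ := hW
    simp only [Beluga.swap, MCtx.get_succ, hW, Option.map_some, MTy.mren_mren]
    rfl

-- Effect of contextual renamings on LF contexts.

theorem Ctx.get_mren (q : ℕ → ℕ) : ∀ (Ψ : Ctx) (i : ℕ) (d : Status × Ty), Ψ.get i = some d →
    (Ψ.mren q).get i = some (d.1, d.2.mren q)
  | .snoc Ψ h A, 0, d, hd => by cases hd; simp [Ctx.get, Ty.shift_mren]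
  | .snoc Ψ h A, i + 1, d, hd => by
    simp only [Ctx.get, Option.map_eq_some_iff] at hd
    obtain ⟨e, he, rfl⟩ := hd
    simp [Ctx.get, Ctx.get_mren q Ψ i e he, Ty.shift_mren]

theorem Ctx.head_mren (q : ℕ → ℕ) : ∀ Ψ : Ctx, (Ψ.mren q).head = Ψ.head.map q
  | .nil => rfl
  | .cvar _ => rfl
  | .snoc Ψ _ _ => Ctx.head_mren q Ψ

theorem Ctx.len_mren (q : ℕ → ℕ) : ∀ Ψ : Ctx, (Ψ.mren q).len = Ψ.len
  | .nil => rfl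
  | .cvar _ => rfl
  | .snoc Ψ _ _ => congrArg (· + 1) (Ctx.len_mren q Ψ)

theorem Ctx.erase_mren (q : ℕ → ℕ) (Ψ : Ctx) : (Ψ.mren q).erase = Ψ.erase.mren q := by
  simp [Ctx.erase, ECtx.mren, Ctx.head_mren, Ctx.len_mren]

/-! ### Closed expressions -/

/-- `r` fixes the variables that are declared in `Ψ`. -/
def Fixes (r : ℕ → ℕ) (Ψ : Ctx) : Prop := ∀ i d, Ψ.get i = some d → r i = i

theorem Fixes.up {r : ℕ → ℕ} {Ψ : Ctx} (hr : Fixes r Ψ) (h : Status) (A : Ty) :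
    Fixes (up r) (.snoc Ψ h A) := by
  intro i d hd
  cases i with
  | zero => rfl
  | succ i =>
    simp only [Ctx.get, Option.map_eq_some_iff] at hd
    obtain ⟨e, he, rfl⟩ := hd
    simp [hr i e he]

mutual
-- A typed term mentions declared variables only. Over the empty context every renaming qualifies,
-- which is how signature declarations are seen to be closed.
theorem Syn.ren_eq {S : Sig} {Δ : MCtx} : ∀ {Ψ : Ctx} {R : Neu} {A : Ty}, Syn S Δ Ψ R A →
    ∀ {r : ℕ → ℕ}, Fixes r Ψ → R.ren r = R
  | _, _, _, .var _ _ _ i _ _ h, _, hr => by simp [hr i _ h]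
  | _, _, _, .const _ _ _ _ _ _, _, _ => rfl
  | _, _, _, .appPi _ _ _ _ _ _ _ _ h₁ h₂ _, _, hr => by simp [h₁.ren_eq hr, h₂.ren_eq hr]
  | _, _, _, .appArr _ _ _ _ _ _ _ h₁ h₂, _, hr => by simp [h₁.ren_eq hr, h₂.ren_eq hr]
  | _, _, _, .mvar _ _ _ _ _ _ _ _ _ h _, _, hr => by simp [h.ren_eq hr]
theorem Chk.ren_eq {S : Sig} {Δ : MCtx} : ∀ {Ψ : Ctx} {M : Nor} {A : Ty}, Chk S Δ Ψ M A →
    ∀ {r : ℕ → ℕ}, Fixes r Ψ → M.ren r = M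
  | _, _, _, .neu _ _ _ _ _ h, _, hr => by simp [h.ren_eq hr]
  | _, _, _, .lamPi _ _ _ _ _ _ h, _, hr => by simp [h.ren_eq (hr.up _ _)]
  | _, _, _, .lamArr _ _ _ _ _ _ h, _, hr => by simp [h.ren_eq (hr.up _ _)]
theorem ChkSub.ren_eq {S : Sig} {Δ : MCtx} : ∀ {Ψ : Ctx} {t : Sub} {Φ : Ctx},
    ChkSub S Δ Ψ t Φ → ∀ {r : ℕ → ℕ}, Fixes r Ψ → t.ren r = t
  | _, _, _, .empty _ _ _, _, _ => rfl
  | _, _, _, .wk _ _ _ _ _, _, _ => rfl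
  | _, _, _, .snoc _ _ _ _ _ _ _ _ _ h₁ _ h₂, _, hr => by simp [h₁.ren_eq hr, h₂.ren_eq hr]
end

theorem AtmKind.ren_eq {S : Sig} {Δ : MCtx} {Ψ : Ctx} {P : Atm} {K : Kind}
    (h : AtmKind S Δ Ψ P K) {r : ℕ → ℕ} (hr : Fixes r Ψ) : P.ren r = P := by
  induction h with
  | const => rfl
  | app _ _ _ _ _ _ h _ ih => simp [ih, h.ren_eq hr]

theorem TyWF.ren_eq {S : Sig} {Δ : MCtx} {Ψ : Ctx} {A : Ty} (h : TyWF S Δ Ψ A) :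
    ∀ {r : ℕ → ℕ}, Fixes r Ψ → A.ren r = A := by
  induction h with
  | atom _ _ h => intro r hr; simp [h.ren_eq hr]
  | pi _ _ _ _ _ ih₁ ih₂ => intro r hr; simp [ih₁ hr, ih₂ (hr.up _ _)]
  | arr _ _ _ _ _ ih₁ ih₂ => intro r hr; simp [ih₁ hr, ih₂ hr]

theorem KindWF.ren_eq {S : Sig} {Δ : MCtx} {Ψ : Ctx} {K : Kind} (h : KindWF S Δ Ψ K) :
    ∀ {r : ℕ → ℕ}, Fixes r Ψ → K.ren r = K := by
  induction h with
  | type => intro r hr; rfl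
  | pi _ _ _ h _ ih => intro r hr; simp [h.ren_eq hr, ih (hr.up _ _)]

-- Absence of contextual variables over the empty meta-context.

mutual
-- An occurrence `u[σ]` needs a declaration of `u`, and `wk_ψ` needs `ψ` at the left end of the
-- ambient context; both are excluded.
theorem Syn.mren_eq {S : Sig} {q : ℕ → ℕ} : ∀ {Ψ : Ctx} {R : Neu} {A : Ty}, Syn S [] Ψ R A →
    Ψ.head = none → R.mren q = R
  | _, _, _, .var _ _ _ _ _ _ _, _ => rfl
  | _, _, _, .const _ _ _ _ _ _, _ => rfl
  | _, _, _, .appPi _ _ _ _ _ _ _ _ h₁ h₂ _, hq => by simp [h₁.mren_eq hq, h₂.mren_eq hq]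
  | _, _, _, .appArr _ _ _ _ _ _ _ h₁ h₂, hq => by simp [h₁.mren_eq hq, h₂.mren_eq hq]
  | _, _, _, .mvar _ _ _ _ _ _ _ _ h _ _, _ => by simp [MCtx.get] at h
theorem Chk.mren_eq {S : Sig} {q : ℕ → ℕ} : ∀ {Ψ : Ctx} {M : Nor} {A : Ty}, Chk S [] Ψ M A →
    Ψ.head = none → M.mren q = M
  | _, _, _, .neu _ _ _ _ _ h, hq => by simp [h.mren_eq hq]
  | _, _, _, .lamPi _ _ _ _ _ _ h, hq => by simp [h.mren_eq hq]
  | _, _, _, .lamArr _ _ _ _ _ _ h, hq => by simp [h.mren_eq hq]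
theorem ChkSub.mren_eq {S : Sig} {q : ℕ → ℕ} : ∀ {Ψ : Ctx} {t : Sub} {Φ : Ctx},
    ChkSub S [] Ψ t Φ → Ψ.head = none → t.mren q = t
  | _, _, _, .empty _ _ _, _ => rfl
  | _, _, _, .wk _ _ _ _ h, hq => by simp [hq] at h
  | _, _, _, .snoc _ _ _ _ _ _ _ _ _ h₁ _ h₂, hq => by simp [h₁.mren_eq hq, h₂.mren_eq hq]
end

theorem AtmKind.mren_eq {S : Sig} {Ψ : Ctx} {P : Atm} {K : Kind}
    (h : AtmKind S [] Ψ P K) {q : ℕ → ℕ} (hq : Ψ.head = none) : P.mren q = P := by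
  induction h with
  | const => rfl
  | app _ _ _ _ _ _ h _ ih => simp [ih, h.mren_eq hq]

theorem TyWF.mren_eq {S : Sig} {Δ : MCtx} {Ψ : Ctx} {A : Ty} (h : TyWF S Δ Ψ A) (hΔ : Δ = [])
    {q : ℕ → ℕ} (hq : Ψ.head = none) : A.mren q = A := by
  subst hΔ
  induction h with
  | atom _ _ h => simp [h.mren_eq hq]
  | pi _ _ _ _ _ ih₁ ih₂ => simp [ih₁ hq, ih₂ hq]
  | arr _ _ _ _ _ ih₁ ih₂ => simp [ih₁ hq, ih₂ hq]

theorem KindWF.mren_eq {S : Sig} {Ψ : Ctx} {K : Kind} (h : KindWF S [] Ψ K)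
    {q : ℕ → ℕ} (hq : Ψ.head = none) : K.mren q = K := by
  induction h with
  | type => rfl
  | pi _ _ _ h _ ih => simp [h.mren_eq rfl hq, ih hq]

theorem CtxWF.closed {S : Sig} {Φ : Ctx} (h : CtxWF S [] Φ) (q : ℕ → ℕ) :
    Φ.head = none ∧ Φ.mren q = Φ := by
  induction h with
  | nil => exact ⟨rfl, rfl⟩
  | cvar _ _ h => simp [MCtx.get] at h
  | snoc _ _ _ _ h ih => exact ⟨ih.1, by simp [ih.2, h.mren_eq rfl ih.1]⟩

/-- All declarations of `S` are closed. -/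
structure Sig.Closed (S : Sig) : Prop where
  tm_ren : ∀ {c A}, Decl.tmc c A ∈ S → ∀ r, A.ren r = A
  tm_mren : ∀ {c A}, Decl.tmc c A ∈ S → ∀ q, A.mren q = A
  ty_ren : ∀ {a K}, Decl.tyc a K ∈ S → ∀ r, K.ren r = K
  ty_mren : ∀ {a K}, Decl.tyc a K ∈ S → ∀ q, K.mren q = K

theorem fixes_nil (r : ℕ → ℕ) : Fixes r .nil := by
  intro i d hd; simp [Ctx.get] at hd

theorem SigWF.closed {S : Sig} (h : SigWF S) : S.Closed := by
  induction h with
  | nil => constructor <;> simp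
  | tyc S a K _ _ hK ih =>
    constructor
    · intro c A hc; simp only [List.mem_cons, reduceCtorEq, false_or] at hc; exact ih.tm_ren hc
    · intro c A hc; simp only [List.mem_cons, reduceCtorEq, false_or] at hc; exact ih.tm_mren hc
    · intro a K hc r
      rcases List.mem_cons.1 hc with h | h
      · cases h; exact hK.ren_eq (fixes_nil r)
      · exact ih.ty_ren h r
    · intro a K hc q
      rcases List.mem_cons.1 hc with h | h
      · cases h; exact hK.mren_eq rfl
      · exact ih.ty_mren h q
  | tmc S c A _ _ hA ih =>
    constructor
    · intro a K hc r
      rcases List.mem_cons.1 hc with h | h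
      · cases h; exact hA.ren_eq (fixes_nil r)
      · exact ih.tm_ren h r
    · intro a K hc q
      rcases List.mem_cons.1 hc with h | h
      · cases h; exact hA.mren_eq rfl rfl
      · exact ih.tm_mren h q
    · intro c A hc; simp only [List.mem_cons, reduceCtorEq, false_or] at hc; exact ih.ty_ren hc
    · intro c A hc; simp only [List.mem_cons, reduceCtorEq, false_or] at hc; exact ih.ty_mren hc

/-! ### Renaming of LF variables in derivations -/

mutual
theorem Syn.ren {S : Sig} (hS : S.Closed) {Δ : MCtx} : ∀ {Ψ : Ctx} {R : Neu} {A : Ty},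
    Syn S Δ Ψ R A → ∀ {r : ℕ → ℕ} {Ψ' : Ctx}, CtxRen r Ψ Ψ' → Syn S Δ Ψ' (R.ren r) (A.ren r)
  | _, _, _, .var _ _ _ i h A hi, _, _, hr => .var _ _ _ _ h _ (hr.get i _ hi)
  | _, _, _, .const _ _ _ c A hc, r, _, _ => .const _ _ _ _ _ (by rwa [hS.tm_ren hc r])
  | _, _, _, .appPi _ _ _ _ M _ _ _ h₁ h₂ h₃, r, _, hr =>
    .appPi _ _ _ _ _ _ _ _ (h₁.ren hS hr) (h₂.ren hS hr) (h₃.ren (Env.one_ren M r))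
  | _, _, _, .appArr _ _ _ _ _ _ _ h₁ h₂, _, _, hr =>
    .appArr _ _ _ _ _ _ _ (h₁.ren hS hr) (h₂.ren hS hr)
  | _, _, _, .mvar _ _ _ _ _ t P P₁ hu h₁ h₂, r, _, hr =>
    .mvar _ _ _ _ _ _ _ _ hu (h₁.ren hS hr) (h₂.ren_result (Sub.env_ren r t))
theorem Chk.ren {S : Sig} (hS : S.Closed) {Δ : MCtx} : ∀ {Ψ : Ctx} {M : Nor} {A : Ty},
    Chk S Δ Ψ M A → ∀ {r : ℕ → ℕ} {Ψ' : Ctx}, CtxRen r Ψ Ψ' → Chk S Δ Ψ' (M.ren r) (A.ren r)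
  | _, _, _, .neu _ _ _ _ _ h, _, _, hr => .neu _ _ _ _ _ (h.ren hS hr)
  | _, _, _, .lamPi _ _ _ _ _ _ h, _, _, hr => .lamPi _ _ _ _ _ _ (h.ren hS (hr.up _ _))
  | _, _, _, .lamArr _ _ _ _ _ B h, r, _, hr =>
    .lamArr _ _ _ _ _ _ (B.shift_ren r ▸ h.ren hS (hr.up _ _))
theorem ChkSub.ren {S : Sig} (hS : S.Closed) {Δ : MCtx} : ∀ {Ψ : Ctx} {t : Sub} {Φ : Ctx},
    ChkSub S Δ Ψ t Φ → ∀ {r : ℕ → ℕ} {Ψ' : Ctx}, CtxRen r Ψ Ψ' → ChkSub S Δ Ψ' (t.ren r) Φ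
  | _, _, _, .empty _ _ _, _, _, _ => .empty _ _ _
  | _, _, _, .wk _ _ _ _ h, _, _, hr => .wk _ _ _ _ (hr.head _ h)
  | _, _, _, .snoc _ _ _ _ t _ _ B _ h₁ h₂ h₃, r, _, hr =>
    .snoc _ _ _ _ _ _ _ _ _ (h₁.ren hS hr) (h₂.ren_result (Sub.env_ren r t)) (h₃.ren hS hr)
end

theorem AtmKind.ren {S : Sig} (hS : S.Closed) {Δ : MCtx} {Ψ Ψ' : Ctx} {P : Atm} {K : Kind}
    (h : AtmKind S Δ Ψ P K) {r : ℕ → ℕ} (hr : CtxRen r Ψ Ψ') :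
    AtmKind S Δ Ψ' (P.ren r) (K.ren r) := by
  induction h with
  | const a K h => exact .const _ _ _ _ _ (by rwa [hS.ty_ren h r])
  | app _ M _ _ _ _ h₁ h₂ ih =>
    exact .app _ _ _ _ _ _ _ _ ih (h₁.ren hS hr) (h₂.ren (Env.one_ren M r))

theorem TyWF.ren {S : Sig} (hS : S.Closed) {Δ : MCtx} {Ψ : Ctx} {A : Ty} (h : TyWF S Δ Ψ A) :
    ∀ {r : ℕ → ℕ} {Ψ' : Ctx}, CtxRen r Ψ Ψ' → TyWF S Δ Ψ' (A.ren r) := by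
  induction h with
  | atom _ _ h => exact fun hr => .atom _ _ _ _ (h.ren hS hr)
  | pi _ _ _ _ _ ih₁ ih₂ => exact fun hr => .pi _ _ _ _ _ (ih₁ hr) (ih₂ (hr.up _ _))
  | arr _ _ _ _ _ ih₁ ih₂ => exact fun hr => .arr _ _ _ _ _ (ih₁ hr) (ih₂ hr)

theorem TyWF.shift {S : Sig} (hS : S.Closed) {Δ : MCtx} {Ψ : Ctx} {A : Ty} (hA : TyWF S Δ Ψ A)
    (h : Status) (B : Ty) : TyWF S Δ (.snoc Ψ h B) A.shift :=
  hA.ren hS (.succ Ψ h B)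

theorem Assum.ren {S : Sig} (hS : S.Closed) {Ψ Ψ' : Ctx} {R : Neu} {A : Ty}
    (h : Assum S Ψ R A) {r : ℕ → ℕ} (hr : CtxRen r Ψ Ψ') : Assum S Ψ' (R.ren r) (A.ren r) := by
  cases h with
  | var i _ h => exact .var _ _ _ _ (hr.get i _ h)
  | const c _ h => exact .const _ _ _ _ (by rwa [hS.tm_ren h r])

mutual
-- Weakening and exchange at once. The rules depend on `Ψ` only through lookup and its leading
-- context variable, and `CtxRen` preserves both, including the distinction between assumptions and
-- parameters. Closedness of the signature keeps the types of constants unchanged.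
theorem LSeq.ren {S : Sig} (hS : S.Closed) {Δ : MCtx} : ∀ {Ψ : Ctx} {M : Nor} {A : Ty},
    LSeq S Δ Ψ M A → ∀ {r : ℕ → ℕ} {Ψ' : Ctx}, CtxRen r Ψ Ψ' → LSeq S Δ Ψ' (M.ren r) (A.ren r)
  | _, _, _, .initS _ _ _ c A hc, r, _, _ => .initS _ _ _ _ _ (by rwa [hS.tm_ren hc r])
  | _, _, _, .initV _ _ _ i A hi, _, _, hr => .initV _ _ _ _ _ (hr.get i _ hi)
  | _, _, _, .piR _ _ _ _ _ _ h, _, _, hr => .piR _ _ _ _ _ _ (h.ren hS (hr.up _ _))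
  | _, _, _, .piL _ _ _ R M _ _ _ _ _ A' h₁ h₂ h₃ h₄ h₅, r, _, hr =>
    .piL _ _ _ _ _ _ _ _ _ _ _ (h₁.ren hS hr) (h₂.ren hS hr) (h₃.ren (Env.one_ren M r))
      (A'.shift_ren r ▸ h₄.ren hS (hr.up _ _)) (h₅.ren (Env.one_ren (.neu (.app R M)) r))
  | _, _, _, .arrR _ _ _ _ _ B h, r, _, hr =>
    .arrR _ _ _ _ _ _ (B.shift_ren r ▸ h.ren hS (hr.up _ _))
  | _, _, _, .arrL _ _ _ R M _ _ _ _ A' h₁ h₂ h₃ h₄, r, _, hr =>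
    .arrL _ _ _ _ _ _ _ _ _ _ (h₁.ren hS hr) (h₂.ren hS hr)
      (A'.shift_ren r ▸ h₃.ren hS (hr.up _ _)) (h₄.ren (Env.one_ren (.neu (.app R M)) r))
  | _, _, _, .reflect _ _ _ _ u t P _ _ _ A h₁ h₂ h₃ h₄ h₅, r, _, hr =>
    .reflect _ _ _ _ _ _ _ _ _ _ _ h₁ (h₂.ren hS hr) (h₃.ren_result (Sub.env_ren r t))
      (A.shift_ren r ▸ h₄.ren hS (hr.up _ _)) (h₅.ren (Env.one_ren (.neu (.mvar u t)) r))
theorem LSeqSub.ren {S : Sig} (hS : S.Closed) {Δ : MCtx} : ∀ {Ψ : Ctx} {t : Sub} {Φ : Ctx},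
    LSeqSub S Δ Ψ t Φ → ∀ {r : ℕ → ℕ} {Ψ' : Ctx}, CtxRen r Ψ Ψ' → LSeqSub S Δ Ψ' (t.ren r) Φ
  | _, _, _, .empty _ _ _, _, _, _ => .empty _ _ _
  | _, _, _, .wk _ _ _ _ h, _, _, hr => .wk _ _ _ _ (hr.head _ h)
  | _, _, _, .subP _ _ _ _ t _ B _ h₁ h₂ h₃, r, _, hr =>
    .subP _ _ _ _ _ _ _ _ (h₁.ren hS hr) (h₂.ren_result (Sub.env_ren r t)) (h₃.ren hS hr)
  | _, _, _, .subU _ _ _ _ t _ B _ h₁ h₂ h₃, r, _, hr =>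
    .subU _ _ _ _ _ _ _ _ (h₁.ren hS hr) (h₂.ren_result (Sub.env_ren r t)) (h₃.ren hS hr)
end

/-! ### Renaming of contextual variables in derivations -/

mutual
theorem Syn.mren {S : Sig} (hS : S.Closed) {Δ Δ' : MCtx} {q : ℕ → ℕ} (hq : MCtxRen q Δ Δ') :
    ∀ {Ψ : Ctx} {R : Neu} {A : Ty}, Syn S Δ Ψ R A →
      Syn S Δ' (Ψ.mren q) (R.mren q) (A.mren q)
  | Ψ, _, _, .var _ _ _ i h A hi => .var _ _ _ _ h _ (Ψ.get_mren q i _ hi)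
  | _, _, _, .const _ _ _ c A hc => .const _ _ _ _ _ (by rwa [hS.tm_mren hc q])
  | _, _, _, .appPi _ _ _ _ M _ _ _ h₁ h₂ h₃ =>
    .appPi _ _ _ _ _ _ _ _ (h₁.mren hS hq) (h₂.mren hS hq) (h₃.mren (Env.one_mren M q))
  | _, _, _, .appArr _ _ _ _ _ _ _ h₁ h₂ =>
    .appArr _ _ _ _ _ _ _ (h₁.mren hS hq) (h₂.mren hS hq)
  | _, _, _, .mvar _ _ _ _ _ t P P₁ hu h₁ h₂ =>
    .mvar _ _ _ _ _ _ _ _ (hq _ _ hu) (h₁.mren hS hq) (h₂.mren (Sub.env_mren q t))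
theorem Chk.mren {S : Sig} (hS : S.Closed) {Δ Δ' : MCtx} {q : ℕ → ℕ} (hq : MCtxRen q Δ Δ') :
    ∀ {Ψ : Ctx} {M : Nor} {A : Ty}, Chk S Δ Ψ M A →
      Chk S Δ' (Ψ.mren q) (M.mren q) (A.mren q)
  | _, _, _, .neu _ _ _ _ _ h => .neu _ _ _ _ _ (h.mren hS hq)
  | _, _, _, .lamPi _ _ _ _ _ _ h => .lamPi _ _ _ _ _ _ (h.mren hS hq)
  | _, _, _, .lamArr _ _ _ _ _ B h => .lamArr _ _ _ _ _ _ (B.shift_mren q ▸ h.mren hS hq)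
theorem ChkSub.mren {S : Sig} (hS : S.Closed) {Δ Δ' : MCtx} {q : ℕ → ℕ} (hq : MCtxRen q Δ Δ') :
    ∀ {Ψ : Ctx} {t : Sub} {Φ : Ctx}, ChkSub S Δ Ψ t Φ →
      ChkSub S Δ' (Ψ.mren q) (t.mren q) (Φ.mren q)
  | _, _, _, .empty _ _ _ => .empty _ _ _
  | Ψ, _, _, .wk _ _ _ _ h => .wk _ _ _ _ (by rw [Ψ.head_mren, h]; rfl)
  | _, _, _, .snoc _ _ _ _ t _ _ B _ h₁ h₂ h₃ =>
    .snoc _ _ _ _ _ _ _ _ _ (h₁.mren hS hq) (h₂.mren (Sub.env_mren q t)) (h₃.mren hS hq)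
end

theorem AtmKind.mren {S : Sig} (hS : S.Closed) {Δ Δ' : MCtx} {q : ℕ → ℕ} (hq : MCtxRen q Δ Δ')
    {Ψ : Ctx} {P : Atm} {K : Kind} (h : AtmKind S Δ Ψ P K) :
    AtmKind S Δ' (Ψ.mren q) (P.mren q) (K.mren q) := by
  induction h with
  | const a K h => exact .const _ _ _ _ _ (by rwa [hS.ty_mren h q])
  | app _ M _ _ _ _ h₁ h₂ ih =>
    exact .app _ _ _ _ _ _ _ _ ih (h₁.mren hS hq) (h₂.mren (Env.one_mren M q))

theorem TyWF.mren {S : Sig} (hS : S.Closed) {Δ Δ' : MCtx} {q : ℕ → ℕ} (hq : MCtxRen q Δ Δ')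
    {Ψ : Ctx} {A : Ty} (h : TyWF S Δ Ψ A) : TyWF S Δ' (Ψ.mren q) (A.mren q) := by
  induction h with
  | atom _ _ h => exact .atom _ _ _ _ (h.mren hS hq)
  | pi _ _ _ _ _ ih₁ ih₂ => exact .pi _ _ _ _ _ ih₁ ih₂
  | arr _ _ _ _ _ ih₁ ih₂ => exact .arr _ _ _ _ _ ih₁ ih₂

theorem CtxWF.mren {S : Sig} (hS : S.Closed) {Δ Δ' : MCtx} {q : ℕ → ℕ} (hq : MCtxRen q Δ Δ')
    {Ψ : Ctx} (h : CtxWF S Δ Ψ) : CtxWF S Δ' (Ψ.mren q) := by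
  induction h with
  | nil => exact .nil _ _
  | cvar p G h => exact .cvar _ _ _ G (hq _ _ h)
  | snoc _ _ _ _ h ih => exact .snoc _ _ _ _ _ ih (h.mren hS hq)

theorem MTyWF.mren {S : Sig} (hS : S.Closed) {Δ Δ' : MCtx} {q : ℕ → ℕ} (hq : MCtxRen q Δ Δ')
    {U : MTy} (h : MTyWF S Δ U) : MTyWF S Δ' (U.mren q) := by
  cases h with
  | term _ _ h₁ h₂ => exact .term _ _ _ _ (h₁.mren hS hq) (h₂.mren hS hq)
  | schema _ h => exact .schema _ _ _ h

theorem CTyWF.mren {S : Sig} (hS : S.Closed) {Δ : MCtx} {t : CTy} (h : CTyWF S Δ t) :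
    ∀ {Δ' : MCtx} {q : ℕ → ℕ}, MCtxRen q Δ Δ' → CTyWF S Δ' (t.mren q) := by
  induction h with
  | box _ _ _ h₁ h₂ => exact fun hq => .box _ _ _ _ (h₁.mren hS hq) (h₂.mren hS hq)
  | arr _ _ _ _ _ ih₁ ih₂ => exact fun hq => .arr _ _ _ _ (ih₁ hq) (ih₂ hq)
  | mpi _ U _ h _ ih => exact fun hq => .mpi _ _ _ _ (h.mren hS hq) (ih (hq.up U))

theorem Assum.mren {S : Sig} (hS : S.Closed) {Ψ : Ctx} {R : Neu} {A : Ty}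
    (h : Assum S Ψ R A) (q : ℕ → ℕ) : Assum S (Ψ.mren q) (R.mren q) (A.mren q) := by
  cases h with
  | var i _ h => exact .var _ _ _ _ (Ψ.get_mren q i _ h)
  | const c _ h => exact .const _ _ _ _ (by rwa [hS.tm_mren h q])

mutual
theorem LSeq.mren {S : Sig} (hS : S.Closed) {Δ Δ' : MCtx} {q : ℕ → ℕ} (hq : MCtxRen q Δ Δ') :
    ∀ {Ψ : Ctx} {M : Nor} {A : Ty}, LSeq S Δ Ψ M A →
      LSeq S Δ' (Ψ.mren q) (M.mren q) (A.mren q)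
  | _, _, _, .initS _ _ _ c A hc => .initS _ _ _ _ _ (by rwa [hS.tm_mren hc q])
  | Ψ, _, _, .initV _ _ _ i A hi => .initV _ _ _ _ _ (Ψ.get_mren q i _ hi)
  | _, _, _, .piR _ _ _ _ _ _ h => .piR _ _ _ _ _ _ (h.mren hS hq)
  | _, _, _, .piL _ _ _ R M _ _ _ _ _ A' h₁ h₂ h₃ h₄ h₅ =>
    .piL _ _ _ _ _ _ _ _ _ _ _ (h₁.mren hS q) (h₂.mren hS hq) (h₃.mren (Env.one_mren M q))
      (A'.shift_mren q ▸ h₄.mren hS hq) (h₅.mren (Env.one_mren (.neu (.app R M)) q))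
  | _, _, _, .arrR _ _ _ _ _ B h => .arrR _ _ _ _ _ _ (B.shift_mren q ▸ h.mren hS hq)
  | _, _, _, .arrL _ _ _ R M _ _ _ _ A' h₁ h₂ h₃ h₄ =>
    .arrL _ _ _ _ _ _ _ _ _ _ (h₁.mren hS q) (h₂.mren hS hq)
      (A'.shift_mren q ▸ h₃.mren hS hq) (h₄.mren (Env.one_mren (.neu (.app R M)) q))
  | _, _, _, .reflect _ _ _ _ u t P _ _ _ A h₁ h₂ h₃ h₄ h₅ =>
    .reflect _ _ _ _ _ _ _ _ _ _ _ (hq _ _ h₁) (h₂.mren hS hq) (h₃.mren (Sub.env_mren q t))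
      (A.shift_mren q ▸ h₄.mren hS hq) (h₅.mren (Env.one_mren (.neu (.mvar u t)) q))
theorem LSeqSub.mren {S : Sig} (hS : S.Closed) {Δ Δ' : MCtx} {q : ℕ → ℕ}
    (hq : MCtxRen q Δ Δ') : ∀ {Ψ : Ctx} {t : Sub} {Φ : Ctx}, LSeqSub S Δ Ψ t Φ →
      LSeqSub S Δ' (Ψ.mren q) (t.mren q) (Φ.mren q)
  | _, _, _, .empty _ _ _ => .empty _ _ _
  | Ψ, _, _, .wk _ _ _ _ h => .wk _ _ _ _ (by rw [Ψ.head_mren, h]; rfl)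
  | _, _, _, .subP _ _ _ _ t _ B _ h₁ h₂ h₃ =>
    .subP _ _ _ _ _ _ _ _ (h₁.mren hS hq) (h₂.mren (Sub.env_mren q t)) (h₃.mren hS hq)
  | _, _, _, .subU _ _ _ _ t _ B _ h₁ h₂ h₃ =>
    .subU _ _ _ _ _ _ _ _ (h₁.mren hS hq) (h₂.mren (Sub.env_mren q t)) (h₃.mren hS hq)
end

/-! ### Simple types -/

/-- Simple types, the skeletons of LF types. -/
inductive STy : Type
  | base : STy
  | arr : STy → STy → STy

def Ty.sk : Ty → STy
  | .atom _ => .base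
  | .pi A B => .arr A.sk B.sk
  | .arr A B => .arr A.sk B.sk

def Ctx.sks : Ctx → List STy
  | .nil => []
  | .cvar _ => []
  | .snoc Ψ _ A => A.sk :: Ψ.sks

/-- The long normal form of a neutral term of a given simple type. -/
def eta : STy → Neu → Nor
  | .base, R => .neu R
  | .arr A B, R => .lam (eta B (.app (R.ren Nat.succ) (eta A (.var 0))))

theorem etaExp_eq : ∀ (A : Ty) (R : Neu), etaExp A R = eta A.sk R
  | .atom _, _ => rfl
  | .pi A B, R => by simp [etaExp, eta, Ty.sk, etaExp_eq A, etaExp_eq B]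
  | .arr A B, R => by simp [etaExp, eta, Ty.sk, etaExp_eq A, etaExp_eq B]

theorem eta_ren : ∀ (T : STy) (R : Neu) (r : ℕ → ℕ), (eta T R).ren r = eta T (R.ren r)
  | .base, _, _ => rfl
  | .arr A B, R, r => by simp [eta, eta_ren A, eta_ren B, Neu.ren_ren, up_comp_succ]

theorem eta_mren : ∀ (T : STy) (R : Neu) (q : ℕ → ℕ), (eta T R).mren q = eta T (R.mren q)
  | .base, _, _ => rfl
  | .arr A B, R, r => by simp [eta, eta_mren A, eta_mren B, Neu.mren_ren]

theorem Ty.sk_ren : ∀ (A : Ty) (r : ℕ → ℕ), (A.ren r).sk = A.sk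
  | .atom _, _ => rfl
  | .pi A B, r => by simp [Ty.sk, A.sk_ren, B.sk_ren]
  | .arr A B, r => by simp [Ty.sk, A.sk_ren, B.sk_ren]

theorem Ty.sk_mren (q : ℕ → ℕ) : ∀ A : Ty, (A.mren q).sk = A.sk
  | .atom _ => rfl
  | .pi A B => by simp [Ty.sk, A.sk_mren, B.sk_mren]
  | .arr A B => by simp [Ty.sk, A.sk_mren, B.sk_mren]

/-- Substitution into a type changes only the arguments of its atoms, and these are erased. Hence
the dependent application rule becomes the simple one. -/
theorem HTy.sk_eq {s : Env} {A A' : Ty} (h : HTy s A A') : A'.sk = A.sk := by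
  induction h with
  | atom => rfl
  | pi _ _ _ _ _ _ _ ih₁ ih₂ => simp [Ty.sk, ih₁, ih₂]
  | arr _ _ _ _ _ _ _ ih₁ ih₂ => simp [Ty.sk, ih₁, ih₂]

theorem Ctx.sks_get : ∀ (Ψ : Ctx) (i : ℕ) (d : Status × Ty), Ψ.get i = some d →
    Ψ.sks[i]? = some d.2.sk
  | .snoc Ψ h A, 0, d, hd => by cases hd; simp [Ctx.sks, Ty.shift, Ty.sk_ren]
  | .snoc Ψ h A, i + 1, d, hd => by
    simp only [Ctx.get, Option.map_eq_some_iff] at hd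
    obtain ⟨e, he, rfl⟩ := hd
    simp [Ctx.sks, Ctx.sks_get Ψ i e he, Ty.shift, Ty.sk_ren]

/-- The skeletons of the contexts of the contextual variables. -/
abbrev SMCtx : Type := ℕ → Option (Option ℕ × List STy)

def MTy.sk : MTy → Option (Option ℕ × List STy)
  | .term Φ _ => some (Φ.head, Φ.sks)
  | .schema _ => none

def MCtx.sk (Δ : MCtx) : SMCtx := fun u => (Δ.get u).bind MTy.sk

mutual
/-- Simple typing of neutral terms; constants may have any type. -/
inductive SNeu (D : SMCtx) (h : Option ℕ) : List STy → Neu → STy → Prop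
  | var (G : List STy) (i : ℕ) (T : STy) : G[i]? = some T → SNeu D h G (.var i) T
  | const (G : List STy) (c : ℕ) (T : STy) : SNeu D h G (.const c) T
  | app (G : List STy) (R : Neu) (M : Nor) (T₁ T₂ : STy) :
      SNeu D h G R (.arr T₁ T₂) → SNor D h G M T₁ → SNeu D h G (.app R M) T₂
  | mvar (G : List STy) (u : ℕ) (t : Sub) (h' : Option ℕ) (G' : List STy) :
      D u = some (h', G') → SSub D h G t h' G' → SNeu D h G (.mvar u t) .base
/-- Simple typing of normal terms. -/
inductive SNor (D : SMCtx) (h : Option ℕ) : List STy → Nor → STy → Prop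
  | neu (G : List STy) (R : Neu) : SNeu D h G R .base → SNor D h G (.neu R) .base
  | lam (G : List STy) (M : Nor) (T₁ T₂ : STy) :
      SNor D h (T₁ :: G) M T₂ → SNor D h G (.lam M) (.arr T₁ T₂)
/-- Simple typing of substitutions. -/
inductive SSub (D : SMCtx) (h : Option ℕ) : List STy → Sub → Option ℕ → List STy → Prop
  | empty (G : List STy) : SSub D h G .empty none []
  | wk (G : List STy) (p : ℕ) : h = some p → SSub D h G (.wk p) (some p) []
  | snoc (G : List STy) (t : Sub) (M : Nor) (h' : Option ℕ) (G' : List STy) (T : STy) :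
      SSub D h G t h' G' → SNor D h G M T → SSub D h G (.snoc t M) h' (T :: G')
end

mutual
-- The passage to simple types, on which the identity laws are proved by induction. Types of
-- constants are forgotten, as constants are never substituted for.
theorem Syn.simple {S : Sig} {Δ : MCtx} : ∀ {Ψ : Ctx} {R : Neu} {A : Ty}, Syn S Δ Ψ R A →
    SNeu Δ.sk Ψ.head Ψ.sks R A.sk
  | Ψ, _, _, .var _ _ _ i _ _ h => .var _ _ _ (Ψ.sks_get i _ h)
  | _, _, _, .const _ _ _ _ _ _ => .const _ _ _
  | _, _, _, .appPi _ _ _ _ _ _ _ _ h₁ h₂ h₃ =>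
    h₃.sk_eq ▸ .app _ _ _ _ _ h₁.simple h₂.simple
  | _, _, _, .appArr _ _ _ _ _ _ _ h₁ h₂ => .app _ _ _ _ _ h₁.simple h₂.simple
  | _, _, _, .mvar _ _ _ _ _ _ _ _ hu h _ =>
    .mvar _ _ _ _ _ (by simp [MCtx.sk, hu, MTy.sk]) h.simple
theorem Chk.simple {S : Sig} {Δ : MCtx} : ∀ {Ψ : Ctx} {M : Nor} {A : Ty}, Chk S Δ Ψ M A →
    SNor Δ.sk Ψ.head Ψ.sks M A.sk
  | _, _, _, .neu _ _ _ _ _ h => .neu _ _ h.simple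
  | _, _, _, .lamPi _ _ _ _ _ _ h => .lam _ _ _ _ h.simple
  | _, _, _, .lamArr _ _ _ _ _ B h => .lam _ _ _ _ (B.sk_ren Nat.succ ▸ h.simple)
theorem ChkSub.simple {S : Sig} {Δ : MCtx} : ∀ {Ψ : Ctx} {t : Sub} {Φ : Ctx},
    ChkSub S Δ Ψ t Φ → SSub Δ.sk Ψ.head Ψ.sks t Φ.head Φ.sks
  | _, _, _, .empty _ _ _ => .empty _
  | _, _, _, .wk _ _ _ _ h => .wk _ _ h
  | _, _, _, .snoc _ _ _ _ _ _ _ _ _ h₁ h₂ h₃ =>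
    .snoc _ _ _ _ _ _ h₁.simple (h₂.sk_eq ▸ h₃.simple)
end

/-! ### The identity property of hereditary substitution -/

/-- If `[s]R` is neutral, then η-expansion commutes with `s`: the variables it introduces are fixed
by the lifted environments. -/
theorem HNeu.eta {T : STy} : ∀ {s : Env} {R R' : Neu}, HNeu s R (.neu R') →
    HNor s (eta T R) (Beluga.eta T R') := by
  induction T with
  | base => exact fun h => .neu _ _ _ h
  | arr A B ihA ihB =>
    intro s R R' h
    refine .lam _ _ _ (ihB (.app _ _ _ _ _ _ (h.ren ?_) (ihA (.var _ _ _ rfl)) (.neu _ _)))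
    intro i M hi
    simp [Env.up, hi]

/-- Substituting a long normal form for the head of a long variable returns that normal form. -/
def EtaSubst (D : SMCtx) (T : STy) : Prop :=
  ∀ (h : Option ℕ) (G : List STy) (s : Env) (R : Neu) (M : Nor), HNeu s R M → SNor D h G M T →
    HNor s (eta T R) M

/-- `EtaSubst` holds at all argument types. -/
def EtaSubstArgs (D : SMCtx) : STy → Prop
  | .base => True
  | .arr A B => EtaSubst D A ∧ EtaSubstArgs D B

/-- `s` maps each variable to itself or to its long normal form. -/
def IdEnv (D : SMCtx) (s : Env) (G : List STy) : Prop :=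
  ∀ i T, G[i]? = some T → s i = some (.neu (.var i)) ∨
    EtaSubstArgs D T ∧ s i = some (eta T (.var i))

theorem IdEnv.up {D : SMCtx} {s : Env} {G : List STy} (hs : IdEnv D s G) (T : STy) :
    IdEnv D s.up (T :: G) := by
  intro i T' hi
  cases i with
  | zero => exact .inl rfl
  | succ i =>
    refine (hs i T' hi).imp ?_ (And.imp_right ?_) <;> intro h <;> simp [Env.up, h, eta_ren]

/-- The substituted variable does not occur in a weakened term. -/
theorem Env.one_shift (N : Nor) (R : Neu) : HNeu (Env.one N) (R.ren Nat.succ) (.neu R) := by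
  -- On raw terms the environment mapping every variable to itself creates no redex and so acts as
  -- the identity; the claim follows by renaming its source variables by the successor.
  have key : ∀ s : Env, (∀ i, s i = some (.neu (.var i))) →
      (∀ R, HNeu s R (.neu R)) := by
    intro s hs R
    refine (Neu.rec (motive_1 := fun R => ∀ s : Env, (∀ i, s i = some (.neu (.var i))) →
        HNeu s R (.neu R))
      (motive_2 := fun M => ∀ s : Env, (∀ i, s i = some (.neu (.var i))) → HNor s M M)
      (motive_3 := fun t => ∀ s : Env, (∀ i, s i = some (.neu (.var i))) → HSub s t t)
      ?_ ?_ ?_ ?_ ?_ ?_ ?_ ?_ ?_ R) s hs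
    · exact fun i s hs => .var _ _ _ (hs i)
    · exact fun _ _ _ => .const _ _
    · exact fun _ _ ih₁ ih₂ s hs => .app _ _ _ _ _ _ (ih₁ s hs) (ih₂ s hs) (.neu _ _)
    · exact fun _ _ ih s hs => .mvar _ _ _ _ (ih s hs)
    · exact fun _ ih s hs => .neu _ _ _ (ih s hs)
    · refine fun _ ih s hs => .lam _ _ _ (ih _ fun i => ?_)
      cases i <;> simp [Env.up, hs]
    · exact fun _ _ => .empty _
    · exact fun _ _ _ => .wk _ _
    · exact fun _ _ ih₁ ih₂ s hs => .snoc _ _ _ _ _ (ih₁ s hs) (ih₂ s hs)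
  have := (key (fun i => some (.neu (.var i))) (fun _ => rfl) R).ren (s' := Env.one N)
    (r := Nat.succ) (q := id) (fun i M hi => by cases hi; rfl)
  rwa [Nor.ren_id] at this

mutual
-- A neutral term is returned either unchanged or η-expanded, depending on what its head variable is
-- mapped to. At base type both outcomes coincide, so normal terms are always returned unchanged.
theorem SNeu.subst_id {D : SMCtx} {h : Option ℕ} : ∀ {G : List STy} {R : Neu} {T : STy},
    SNeu D h G R T → ∀ {s : Env}, IdEnv D s G →
      HNeu s R (.neu R) ∨ EtaSubstArgs D T ∧ HNeu s R (eta T R)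
  | _, _, _, .var _ i T hi, _, hs => (hs i T hi).imp (.var _ _ _) (And.imp_right (.var _ _ _))
  | _, _, _, .const _ _ _, _, _ => .inl (.const _ _)
  | _, _, _, .app _ R M _ _ h₁ h₂, _, hs =>
    (h₁.subst_id hs).imp
      (fun hR => .app _ _ _ _ _ _ hR (h₂.subst_id hs) (.neu _ _))
      -- The head became `λx. η(R x)` with `x` in long form. Contracting it with `M` gives `η(R M)`,
      -- because `[M/x]η(x) = M` at the argument type; this is all that `EtaSubstArgs` has to
      -- provide.
      (fun ⟨hT, hR⟩ => ⟨hT.2, .app _ _ _ _ _ _ hR (h₂.subst_id hs) (.beta _ _ _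
        (HNeu.eta (.app _ _ _ _ _ _ (Env.one_shift M R)
          (hT.1 _ _ _ _ _ (.var _ _ _ rfl) h₂) (.neu _ _))))⟩)
  | _, _, _, .mvar _ _ _ _ _ _ h, _, hs => .inl (.mvar _ _ _ _ (h.subst_id hs))
theorem SNor.subst_id {D : SMCtx} {h : Option ℕ} : ∀ {G : List STy} {M : Nor} {T : STy},
    SNor D h G M T → ∀ {s : Env}, IdEnv D s G → HNor s M M
  | _, _, _, .neu _ _ h, _, hs => (h.subst_id hs).elim (.neu _ _ _) fun h => .neu _ _ _ h.2
  | _, _, _, .lam _ _ _ _ h, _, hs => .lam _ _ _ (h.subst_id (hs.up _))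
theorem SSub.subst_id {D : SMCtx} {h : Option ℕ} : ∀ {G : List STy} {t : Sub} {h' : Option ℕ}
    {G' : List STy}, SSub D h G t h' G' → ∀ {s : Env}, IdEnv D s G → HSub s t t
  | _, _, _, _, .empty _, _, _ => .empty _
  | _, _, _, _, .wk _ _ _, _, _ => .wk _ _
  | _, _, _, _, .snoc _ _ _ _ _ _ h₁ h₂, _, hs =>
    .snoc _ _ _ _ _ (h₁.subst_id hs) (h₂.subst_id hs)
end

/-- At `A → B` the law requires the identity property for an environment containing a long variable
of type `A`, and that property requires the law at the argument types of `A` only. Proving both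
components together by induction on the type removes the circularity. -/
theorem etaSubst (D : SMCtx) (T : STy) : EtaSubst D T ∧ EtaSubstArgs D T := by
  induction T with
  | base => exact ⟨fun h G s R M hM _ => .neu _ _ _ hM, trivial⟩
  | arr A B ihA ihB =>
    refine ⟨fun h G s R M hM hT => ?_, ihA.1, ihB.2⟩
    cases hT with
    | lam _ M _ _ hT =>
    -- With `λM` for the value of `R`, the lifted head applied to `η(x)` contracts to `[η(x)/x]M =
    -- M`, and the law at `B` applies to this result.
    refine .lam _ _ _ (ihB.1 h _ _ _ _ (.app _ _ _ _ _ _ (hM.ren (r := Nat.succ)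
      (q := Nat.succ) ?_) (HNeu.eta (.var _ _ _ rfl)) (.beta _ _ _ ?_)) hT)
    · intro i N hi
      simp [Env.up, hi]
    -- The contraction acts on `M` weakened below its bound variable. Composed with that weakening
    -- it is the environment sending variable `0` to its long form and fixing the others.
    · have hid : IdEnv D (fun i => i.casesOn (some (eta A (.var 0)))
          fun j => some (.neu (.var (j + 1)))) (A :: G) := by
        intro i T hi
        cases i with
        | zero => cases hi; exact .inr ⟨ihA.2, rfl⟩
        | succ i => exact .inl rfl
      have := (hT.subst_id hid).ren (s' := Env.one (eta A (.var 0))) (r := up Nat.succ)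
        (q := id) (fun i N hi => by cases i <;> cases hi <;> simp [Env.one, Nor.ren_id])
      rwa [Nor.ren_id] at this

theorem idEnv_of_eta {D : SMCtx} {s : Env} {G : List STy}
    (h : ∀ i T, G[i]? = some T → s i = some (.neu (.var i)) ∨ s i = some (eta T (.var i))) :
    IdEnv D s G :=
  fun i T hi => (h i T hi).imp_right fun h => ⟨(etaSubst D T).2, h⟩

theorem AtmKind.subst_id {S : Sig} {Δ : MCtx} {Ψ : Ctx} {P : Atm} {K : Kind}
    (h : AtmKind S Δ Ψ P K) {s : Env} (hs : IdEnv Δ.sk s Ψ.sks) : HAtm s P P := by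
  induction h with
  | const => exact .const _ _
  | app _ _ _ _ _ _ h _ ih => exact .app _ _ _ _ _ ih (h.simple.subst_id hs)

theorem TyWF.subst_id {S : Sig} {Δ : MCtx} {Ψ : Ctx} {A : Ty} (h : TyWF S Δ Ψ A) :
    ∀ {s : Env}, IdEnv Δ.sk s Ψ.sks → HTy s A A := by
  induction h with
  | atom _ _ h => exact fun hs => .atom _ _ _ (h.subst_id hs)
  | pi _ _ _ _ _ ih₁ ih₂ => exact fun hs => .pi _ _ _ _ _ (ih₁ hs) (ih₂ (hs.up _))
  | arr _ _ _ _ _ ih₁ ih₂ => exact fun hs => .arr _ _ _ _ _ (ih₁ hs) (ih₂ hs)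

/-- `[η(x)/x]B = B`, where `B` on the left is weakened. -/
theorem TyWF.one_etaExp {S : Sig} {Δ : MCtx} {Ψ : Ctx} {A B : Ty} {h : Status}
    (hB : TyWF S Δ (.snoc Ψ h A) B) :
    HTy (Env.one (etaExp A (.var 0))) (B.ren (up Nat.succ)) B := by
  have hid : IdEnv Δ.sk (fun i => i.casesOn (some (eta A.sk (.var 0)))
      fun j => some (.neu (.var (j + 1)))) (Ctx.snoc Ψ h A).sks := by
    refine idEnv_of_eta fun i T hi => ?_
    cases i with
    | zero => cases hi; exact .inr rfl
    | succ i => exact .inl rfl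
  have := (hB.subst_id hid).ren (s' := Env.one (eta A.sk (.var 0))) (r := up Nat.succ)
    (q := id) (fun i N hi => by cases i <;> cases hi <;> simp [Env.one, Nor.ren_id])
  rwa [Ty.ren_id, ← etaExp_eq] at this

/-! ### Typing of long normal forms and of identity substitutions -/

/-- The induction is on the skeleton, since the types in the recursive calls are weakened and are
not subterms of `A`. In the dependent case the body has type `[η(x)/x]B`, which is `B` again. -/
theorem Syn.chk_etaExp {S : Sig} (hS : S.Closed) {Δ : MCtx} (T : STy) :
    ∀ {Ψ : Ctx} {R : Neu} {A : Ty}, A.sk = T → TyWF S Δ Ψ A → Syn S Δ Ψ R A →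
      Chk S Δ Ψ (etaExp A R) A := by
  induction T with
  | base =>
    intro Ψ R A hA hwf hR
    cases A with
    | atom P => exact .neu _ _ _ _ _ hR
    | pi => simp [Ty.sk] at hA
    | arr => simp [Ty.sk] at hA
  | arr T₁ T₂ ih₁ ih₂ =>
    -- The induction hypothesis at the argument type, applied to the freshly bound variable.
    have var : ∀ {Ψ : Ctx} {A : Ty} (h : Status), A.sk = T₁ → TyWF S Δ Ψ A →
        Chk S Δ (.snoc Ψ h A) (etaExp A (.var 0)) A.shift := by
      intro Ψ A h hA hwf
      have := ih₁ (A := A.shift) (by rw [Ty.shift, Ty.sk_ren, hA]) (hwf.shift hS h A)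
        (.var _ _ (.snoc Ψ h A) 0 h _ rfl)
      rwa [etaExp_eq, Ty.shift, Ty.sk_ren, ← etaExp_eq] at this
    intro Ψ R A hA hwf hR
    cases hwf with
    | atom => simp [Ty.sk] at hA
    | pi _ A B hwA hwB =>
      simp only [Ty.sk, STy.arr.injEq] at hA
      exact .lamPi _ _ _ _ _ _ (ih₂ hA.2 hwB (.appPi _ _ _ _ _ _ _ _
        (hR.ren hS (.succ Ψ .param A)) (var .param hA.1 hwA) hwB.one_etaExp))
    | arr _ A B hwA hwB =>
      simp only [Ty.sk, STy.arr.injEq] at hA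
      have := ih₂ (by rw [Ty.shift, Ty.sk_ren, hA.2]) (hwB.shift hS .proof A)
        (.appArr _ _ _ _ _ _ _ (hR.ren hS (.succ Ψ .proof A)) (var .proof hA.1 hwA))
      rw [etaExp_eq, Ty.shift, Ty.sk_ren, ← etaExp_eq] at this
      exact .lamArr _ _ _ _ _ _ this

theorem TyWF.chk_etaExp {S : Sig} (hS : S.Closed) {Δ : MCtx} {Ψ : Ctx} {A : Ty}
    (hA : TyWF S Δ Ψ A) (h : Status) :
    Chk S Δ (.snoc Ψ h A) (etaExp A (.var 0)) A.shift := by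
  have := Syn.chk_etaExp hS _ rfl (hA.shift hS h A) (.var _ _ (.snoc Ψ h A) 0 h _ rfl)
  rwa [etaExp_eq, Ty.shift, Ty.sk_ren, ← etaExp_eq] at this

theorem Ctx.idSub_ren (m : ℕ) : ∀ (Φ : Ctx) (n : ℕ),
    (Φ.idSub n).ren (· + m) = Φ.idSub (n + m)
  | .nil, _ => rfl
  | .cvar _, _ => rfl
  | .snoc Φ h A, n => by
    simp [Ctx.idSub, Ctx.idSub_ren m Φ, etaExp_eq, eta_ren, Nat.add_right_comm]

theorem Ctx.idSub_mren (q : ℕ → ℕ) : ∀ (Φ : Ctx) (n : ℕ),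
    (Φ.idSub n).mren q = (Φ.mren q).idSub n
  | .nil, _ => rfl
  | .cvar _, _ => rfl
  | .snoc Φ h A, n => by
    simp [Ctx.idSub, Ctx.idSub_mren q Φ, etaExp_eq, eta_mren, Ty.sk_mren]

theorem Ctx.idSub_env : ∀ (Φ : Ctx) (n i : ℕ) (T : STy), Φ.sks[i]? = some T →
    (Φ.idSub n).env i = some (eta T (.var (i + n)))
  | .snoc Φ h A, n, 0, T, hT => by cases hT; simp [Ctx.idSub, Sub.env, etaExp_eq]
  | .snoc Φ h A, n, i + 1, T, hT => by
    have := Ctx.idSub_env Φ (n + 1) i T hT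
    simp only [Ctx.idSub, Sub.env, this]
    congr 3
    omega

theorem Ctx.idEnv_idSub (D : SMCtx) (Φ : Ctx) : IdEnv D (Φ.idSub 0).env Φ.sks :=
  idEnv_of_eta fun i T hi => .inr (Φ.idSub_env 0 i T hi)

/-- The offset `n` counts the declarations to the right of `Φ`; passing to a prefix of `Φ` increases
it by one, so it must be general for the induction. -/
theorem CtxWF.chkSub_idSub {S : Sig} (hS : S.Closed) {Δ : MCtx} {Φ : Ctx} (h : CtxWF S Δ Φ) :
    ∀ {Ψ : Ctx} {n : ℕ}, CtxRen (· + n) Φ Ψ → ChkSub S Δ Ψ (Φ.idSub n) Φ := by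
  induction h with
  | nil => exact fun _ => .empty _ _ _
  | cvar _ _ _ => exact fun hr => .wk _ _ _ _ (hr.head _ rfl)
  | snoc Φ h A _ hA ih =>
    intro Ψ n hr
    have hr' : CtxRen (· + (n + 1)) Φ Ψ := by
      refine ⟨fun i d hd => ?_, hr.head⟩
      have := hr.get (i + 1) _ (by rw [Ctx.get_succ, hd]; rfl)
      rw [Nat.add_right_comm, Nat.add_assoc] at this
      rw [this]
      simp only [Ty.shift, Ty.ren_ren]
      congr 3
      funext j
      simp [Nat.add_right_comm, Nat.add_assoc]
    have e : A.shift.ren (· + n) = A.ren (· + (n + 1)) := by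
      rw [Ty.shift, Ty.ren_ren]
      congr 1
      funext j
      simp [Nat.add_right_comm, Nat.add_assoc]
    refine .snoc _ _ _ _ _ _ _ _ (A.ren (· + (n + 1))) (ih hr') ?_ ?_
    -- First `[id]A = A` at offset `0`, then the result is renamed by `n + 1`, which turns the
    -- identity substitution into the one required.
    · refine (hA.subst_id (Φ.idEnv_idSub _)).ren_result fun i M hM => ?_
      have := Sub.env_ren (· + (n + 1)) _ i M hM
      rwa [Ctx.idSub_ren, Nat.zero_add] at this
    · have hv : Syn S Δ Ψ (.var (0 + n)) (A.shift.ren (· + n)) :=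
        .var _ _ _ _ h _ (hr.get 0 _ rfl)
      rw [e] at hv
      have := Syn.chk_etaExp hS _ rfl (hA.ren hS hr') hv
      rwa [etaExp_eq, Ty.sk_ren, ← etaExp_eq, Nat.zero_add] at this

theorem CtxRen.add_zero (Ψ : Ctx) : CtxRen (· + 0) Ψ Ψ :=
  ⟨fun _ d hd => hd.trans (congrArg (fun A => some (d.1, A)) d.2.ren_id.symm), fun _ h => h⟩

/-! ### The identity property of hereditary meta-substitution -/

/-- The entries of `id_Φ` are long variables, and `t` takes each of them to its own entry by
`etaSubst`. This makes `X[id_Φ]` neutral for meta-substitution: `[t](X[id_Φ]) = X[t]`. -/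
theorem SSub.subst_idSub {D : SMCtx} {h : Option ℕ} {G : List STy} (Φ : Ctx) :
    ∀ {t : Sub}, SSub D h G t Φ.head Φ.sks → ∀ {s : Env} {n : ℕ},
      (∀ i M, t.env i = some M → s (i + n) = some M) → HSub s (Φ.idSub n) t := by
  induction Φ with
  | nil => intro t ht; cases ht; exact fun _ => .empty _
  | cvar p => intro t ht; cases ht; exact fun _ => .wk _ _
  | snoc Φ _ A ih =>
    intro t ht s n hs
    change SSub D h G t Φ.head (A.sk :: Φ.sks) at ht
    generalize hh : Φ.head = h' at ht
    cases ht with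
    | snoc _ t M _ _ _ h₁ h₂ =>
    subst hh
    refine .snoc _ _ _ _ _ (ih h₁ fun i N hN => ?_) ?_
    · have := hs (i + 1) N hN
      rwa [Nat.add_right_comm] at this
    · rw [etaExp_eq]
      exact (etaSubst D A.sk).1 _ _ _ _ _ (.var _ _ _ (by simpa using hs 0 M rfl)) h₂

/-- `C` is the contextual variable `k` in long normal form, and `r` makes room for a copy of `k`
in `Δ`. -/
structure MetaId (k : ℕ) (C : MTm) (r : ℕ → ℕ) (Δ : MCtx) : Prop where
  self : r k = k
  other : ∀ i, i ≠ k → r i ≠ k ∧ drop k (r i) = i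
  term : ∀ Φ P, Δ.get k = some (.term Φ P) → ∃ e, C = .term e (.mvar k (Φ.idSub 0))
  schema : ∀ G, Δ.get k = some (.schema G) → C = .ctx (.cvar k)

theorem drop_succ (k i : ℕ) (_ : i ≠ k) : drop (k + 1) (i + 1) = drop k i + 1 := by
  unfold drop; split_ifs <;> omega

theorem MetaId.up {k : ℕ} {C : MTm} {r : ℕ → ℕ} {Δ : MCtx} (hC : MetaId k C r Δ) (U : MTy) :
    MetaId (k + 1) (C.mren Nat.succ) (up r) (U :: Δ) where
  self := by simp [hC.self]
  other i hi := by
    cases i with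
    | zero => simp [drop]
    | succ i =>
      have := hC.other i (by omega)
      exact ⟨by simpa using this.1, by simp [drop_succ _ _ this.1, this.2]⟩
  term Φ P hP := by
    rw [MCtx.get_succ, Option.map_eq_some_iff] at hP
    obtain ⟨U, hU, hP⟩ := hP
    cases U with
    | schema G => simp at hP
    | term Φ' P' =>
      simp only [MTy.mren_term, MTy.term.injEq] at hP
      obtain ⟨e, rfl⟩ := hC.term _ _ hU
      exact ⟨_, by simp [Ctx.idSub_mren, ← hP.1]; rfl⟩
  schema G hG := by
    rw [MCtx.get_succ, Option.map_eq_some_iff] at hG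
    obtain ⟨U, hU, hG⟩ := hG
    cases U with
    | term Φ' P' => simp at hG
    | schema G => rw [hC.schema _ hU]; rfl

mutual
-- The renamed term uses `k` for the variable to be replaced and leaves room for its copy;
-- replacement followed by `drop` restores all indices. Neutral terms stay neutral, so no
-- application is contracted. The condition on `h` makes a leading context variable a schema
-- variable, for which `C` is a context.
theorem SNeu.meta_id {Δ : MCtx} {h : Option ℕ} {k : ℕ} {C : MTm} {r : ℕ → ℕ}
    (hC : MetaId k C r Δ) (hh : ∀ p, h = some p → ∃ G, Δ.get p = some (.schema G)) :
    ∀ {G : List STy} {R : Neu} {T : STy}, SNeu Δ.sk h G R T →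
      ∀ n, MNeu k C n (R.mren r) (.neu R)
  | _, _, _, .var _ _ _ _, _ => .var _ _ _ _
  | _, _, _, .const _ _ _, _ => .const _ _ _ _
  | _, _, _, .app _ _ _ _ _ h₁ h₂, n =>
    .app _ _ _ _ _ _ _ _ (h₁.meta_id hC hh n) (h₂.meta_id hC hh n) (.neu _ _)
  | _, _, _, .mvar G u t h' G' hu ht, n => by
    have ht' := ht.meta_id hC hh n
    by_cases e : u = k
    · subst e
      simp only [MCtx.sk, Option.bind_eq_some_iff] at hu
      obtain ⟨U, hU, hu⟩ := hu
      cases U with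
      | schema => simp [MTy.sk] at hu
      | term Φ P =>
        cases hu
        obtain ⟨e, rfl⟩ := hC.term _ _ hU
        rw [Neu.mren, hC.self]
        exact .self _ _ _ _ _ _ _ ht' (.mvar _ _ _ _ (ht.subst_idSub Φ fun i M hM => hM))
    · have := hC.other u e
      have h := MNeu.other k C n (r u) _ _ this.1 ht'
      rwa [this.2] at h
theorem SNor.meta_id {Δ : MCtx} {h : Option ℕ} {k : ℕ} {C : MTm} {r : ℕ → ℕ}
    (hC : MetaId k C r Δ) (hh : ∀ p, h = some p → ∃ G, Δ.get p = some (.schema G)) :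
    ∀ {G : List STy} {M : Nor} {T : STy}, SNor Δ.sk h G M T →
      ∀ n, MNor k C n (M.mren r) M
  | _, _, _, .neu _ _ h, n => .neu _ _ _ _ _ (h.meta_id hC hh n)
  | _, _, _, .lam _ _ _ _ h, n => .lam _ _ _ _ _ (h.meta_id hC hh (n + 1))
theorem SSub.meta_id {Δ : MCtx} {h : Option ℕ} {k : ℕ} {C : MTm} {r : ℕ → ℕ}
    (hC : MetaId k C r Δ) (hh : ∀ p, h = some p → ∃ G, Δ.get p = some (.schema G)) :
    ∀ {G : List STy} {t : Sub} {h' : Option ℕ} {G' : List STy}, SSub Δ.sk h G t h' G' →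
      ∀ n, MSub k C n (t.mren r) t
  | _, _, _, _, .empty _, _ => .empty _ _ _
  | _, _, _, _, .wk _ p hp, n => by
    by_cases e : p = k
    · subst e
      obtain ⟨G, hG⟩ := hh p hp
      obtain rfl := hC.schema G hG
      rw [Sub.mren, hC.self]
      exact .self _ _ _
    · have := hC.other p e
      have h := MSub.other k C n (r p) this.1
      rwa [this.2] at h
  | _, _, _, _, .snoc _ _ _ _ _ _ h₁ h₂, n =>
    .snoc _ _ _ _ _ _ _ (h₁.meta_id hC hh n) (h₂.meta_id hC hh n)
end

theorem AtmKind.meta_id {S : Sig} {Δ : MCtx} {Ψ : Ctx} {P : Atm} {K : Kind}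
    (h : AtmKind S Δ Ψ P K) {k : ℕ} {C : MTm} {r : ℕ → ℕ} (hC : MetaId k C r Δ)
    (hh : ∀ p, Ψ.head = some p → ∃ G, Δ.get p = some (.schema G)) (n : ℕ) :
    MAtm k C n (P.mren r) P := by
  induction h with
  | const => exact .const _ _ _ _
  | app _ _ _ _ _ _ h _ ih => exact .app _ _ _ _ _ _ _ ih (h.simple.meta_id hC hh n)

theorem TyWF.meta_id {S : Sig} {Δ : MCtx} {Ψ : Ctx} {A : Ty} (h : TyWF S Δ Ψ A) {k : ℕ}
    {C : MTm} {r : ℕ → ℕ} (hC : MetaId k C r Δ) :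
    (∀ p, Ψ.head = some p → ∃ G, Δ.get p = some (.schema G)) →
      ∀ n, MSTy k C n (A.mren r) A := by
  induction h with
  | atom _ _ h => exact fun hh n => .atom _ _ _ _ _ (h.meta_id hC hh n)
  | pi _ _ _ _ _ ih₁ ih₂ => exact fun hh n => .pi _ _ _ _ _ _ _ (ih₁ hh n) (ih₂ hh (n + 1))
  | arr _ _ _ _ _ ih₁ ih₂ => exact fun hh n => .arr _ _ _ _ _ _ _ (ih₁ hh n) (ih₂ hh n)

theorem CtxWF.head_schema {S : Sig} {Δ : MCtx} {Ψ : Ctx} (h : CtxWF S Δ Ψ) :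
    ∀ p, Ψ.head = some p → ∃ G, Δ.get p = some (.schema G) := by
  induction h with
  | nil => intro p hp; cases hp
  | cvar _ G h => intro p hp; cases hp; exact ⟨G, h⟩
  | snoc _ _ _ _ _ ih => exact ih

theorem CtxWF.meta_id {S : Sig} {Δ : MCtx} {Ψ : Ctx} (h : CtxWF S Δ Ψ) {k : ℕ}
    {C : MTm} {r : ℕ → ℕ} (hC : MetaId k C r Δ) : MSCtx k C (Ψ.mren r) Ψ := by
  induction h with
  | nil => exact .nil _ _
  | cvar p G hp =>
    by_cases e : p = k
    · subst e
      obtain rfl := hC.schema G hp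
      rw [Ctx.mren, hC.self]
      exact .self _ _
    · have := hC.other p e
      have h := MSCtx.other k C (r p) this.1
      rwa [this.2] at h
  | snoc _ _ _ h hA ih => exact .snoc _ _ _ _ _ _ _ ih (hA.meta_id hC h.head_schema _)

theorem MTyWF.meta_id {S : Sig} {Δ : MCtx} {U : MTy} (h : MTyWF S Δ U) {k : ℕ}
    {C : MTm} {r : ℕ → ℕ} (hC : MetaId k C r Δ) : MSMTy k C (U.mren r) U := by
  cases h with
  | term _ _ h₁ h₂ =>
    cases h₂ with
    | atom _ _ h₂ => exact .term _ _ _ _ _ _ (h₁.meta_id hC) (h₂.meta_id hC h₁.head_schema _)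
  | schema => exact .schema _ _ _

theorem CTyWF.meta_id {S : Sig} {Δ : MCtx} {t : CTy} (h : CTyWF S Δ t) : ∀ {k : ℕ}
    {C : MTm} {r : ℕ → ℕ}, MetaId k C r Δ → MSCTy k C (t.mren r) t := by
  induction h with
  | box _ _ _ h₁ h₂ =>
    intro k C r hC
    cases h₂ with
    | atom _ _ h₂ => exact .box _ _ _ _ _ _ (h₁.meta_id hC) (h₂.meta_id hC h₁.head_schema _)
  | arr _ _ _ _ _ ih₁ ih₂ => exact fun hC => .arr _ _ _ _ _ _ (ih₁ hC) (ih₂ hC)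
  | mpi _ U _ h _ ih => exact fun hC => .mpi _ _ _ _ _ _ (h.meta_id hC) (ih (hC.up U))

/-- Every well-formed meta type has, in its own scope, the contextual variable in long normal form
as an inhabitant. -/
theorem MTyWF.exists_identity {S : Sig} (hS : S.Closed) {Δ : MCtx} {U : MTy}
    (h : MTyWF S Δ U) : ∃ C, MChk S (U :: Δ) C (U.mren Nat.succ) ∧
      MetaId 0 C (Beluga.up Nat.succ) (U :: Δ) := by
  have hr : ∀ i, i ≠ 0 → up Nat.succ i ≠ 0 ∧ drop 0 (up Nat.succ i) = i := by
    intro i hi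
    obtain ⟨i, rfl⟩ := Nat.exists_eq_succ_of_ne_zero hi
    simp [drop]
  cases h with
  | term Ψ P h₁ h₂ =>
    -- The witness is `X[id_Ψ]`. Its synthesized type is `[id_Ψ]P`, which equals `P` by the identity
    -- property.
    refine ⟨.term (Ψ.mren Nat.succ).erase (.mvar 0 ((Ψ.mren Nat.succ).idSub 0)),
      .term _ _ _ _ _ (.neu _ _ _ _ _ (.mvar _ _ _ _ _ _ _ _ rfl
        ((h₁.mren hS (.succ Δ (.term Ψ P))).chkSub_idSub hS (.add_zero _)) ?_)), rfl, hr, ?_, ?_⟩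
    · cases h₂.mren hS (.succ Δ (.term Ψ P)) with
      | atom _ _ h => exact h.subst_id (Ctx.idEnv_idSub _ _)
    · intro Φ Q hQ
      simp only [MCtx.get_zero, MTy.mren_term, Option.some.injEq, MTy.term.injEq] at hQ
      exact ⟨_, by rw [hQ.1]⟩
    · intro G hG
      simp [MCtx.get_zero] at hG
  | schema G h =>
    refine ⟨.ctx (.cvar 0), .ctx _ _ _ _ (.cvar _ _ _ _ rfl), rfl, hr, ?_, ?_⟩
    · intro Φ Q hQ
      simp [MCtx.get_zero] at hQ
    · exact fun _ _ => rfl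

/-! ### Invertibility of the right rules for LF -/

/-- `RightRule C h A B`: the right rule for `C` adds a declaration of `A` of status `h` to the
context and has the succedent `B` in its premise. -/
inductive RightRule : Ty → Status → Ty → Ty → Prop
  | pi (A B : Ty) : RightRule (.pi A B) .param A B
  | arr (A B : Ty) : RightRule (.arr A B) .proof A B.shift

theorem RightRule.shift {C A B : Ty} {h : Status} (hC : RightRule C h A B) :
    RightRule C.shift h A.shift (B.ren (up Nat.succ)) := by
  cases hC with
  | pi => exact .pi _ _
  | arr A B => exact B.shift_ren Nat.succ ▸ .arr _ _

/-- The premise of an inverted left rule, with the two latest declarations exchanged. -/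
theorem LFDerivable.exchange {S : Sig} (hS : S.Closed) {Δ : MCtx} {Ψ : Ctx} {h h' : Status}
    {A B C : Ty}
    (hB : LFDerivable S Δ (.snoc (.snoc Ψ h' C) h A.shift) (B.ren (up Nat.succ))) :
    LFDerivable S Δ (.snoc (.snoc Ψ h A) h' C.shift) B.shift := by
  obtain ⟨N, hN⟩ := hB
  have := hN.ren hS (.swap Ψ h' h C A)
  rw [Ty.ren_ren, swap_comp_up_succ] at this
  exact ⟨_, this⟩

/-- The left rule without its proof term: `R M` is neutral, so its substitution into the term of the
premise is always defined. -/
theorem LFDerivable.piL {S : Sig} {Δ : MCtx} {Ψ : Ctx} {R : Neu} {M : Nor} {A B B' C : Ty}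
    (hR : Assum S Ψ R (.pi A B)) (hM : Chk S Δ Ψ M A) (hB : HTy (Env.one M) B B')
    (hC : LFDerivable S Δ (.snoc Ψ .proof B') C.shift) : LFDerivable S Δ Ψ C := by
  obtain ⟨N, hN⟩ := hC
  obtain ⟨N', hN'⟩ := (Env.neutral_one (.app R M)).exists_nor N
  exact ⟨_, .piL _ _ _ _ _ _ _ _ _ _ _ hR hM hB hN hN'⟩

theorem LFDerivable.arrL {S : Sig} {Δ : MCtx} {Ψ : Ctx} {R : Neu} {A B C : Ty}
    (hR : Assum S Ψ R (.arr A B)) (hA : LFDerivable S Δ Ψ A)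
    (hC : LFDerivable S Δ (.snoc Ψ .proof B) C.shift) : LFDerivable S Δ Ψ C := by
  obtain ⟨M, hM⟩ := hA
  obtain ⟨N, hN⟩ := hC
  obtain ⟨N', hN'⟩ := (Env.neutral_one (.app R M)).exists_nor N
  exact ⟨_, .arrL _ _ _ _ _ _ _ _ _ _ hR hM hN hN'⟩

theorem LFDerivable.reflect {S : Sig} {Δ : MCtx} {Ψ Φ : Ctx} {u : ℕ} {t : Sub} {P P' : Atm}
    {C : Ty} (hu : Δ.get u = some (.term Φ P)) (ht : LSeqSub S Δ Ψ t Φ) (hP : HAtm t.env P P')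
    (hC : LFDerivable S Δ (.snoc Ψ .proof (.atom P')) C.shift) : LFDerivable S Δ Ψ C := by
  obtain ⟨N, hN⟩ := hC
  obtain ⟨N', hN'⟩ := (Env.neutral_one (.mvar u t)).exists_nor N
  exact ⟨_, .reflect _ _ _ _ _ _ _ _ _ _ _ hu ht hP hN hN'⟩

/-- The init case, that is, the η-expansion of an assumption. -/
theorem Assum.right_premise {S : Sig} (hS : S.Closed) {Δ : MCtx} {Ψ : Ctx} {R : Neu}
    {A B C : Ty} {h : Status} (hR : Assum S Ψ R C) (hC : RightRule C h A B)
    (hwf : TyWF S Δ Ψ C) : LFDerivable S Δ (.snoc Ψ h A) B := by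
  have hR' := hR.ren hS (.succ Ψ h A)
  cases hC with
  | pi =>
    cases hwf with
    | pi _ _ _ hA hB =>
      -- The new variable is a parameter, which init may not use; the argument premise of `ΠL` is
      -- ordinary type checking, where parameters are allowed. The instantiated codomain is `B`
      -- itself, so init closes the goal.
      exact .piL hR' (hA.chk_etaExp hS .param) hB.one_etaExp ⟨_, .initV _ _ _ 0 _ rfl⟩
  | arr => exact .arrL hR' ⟨_, .initV _ _ _ 0 _ rfl⟩ ⟨_, .initV _ _ _ 0 _ rfl⟩

/-- Both LF right rules are treated together through `RightRule`. Well-formedness is needed of the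
succedent only, as nothing else is η-expanded, and it survives the weakening in each left rule. -/
theorem LSeq.right_premise {S : Sig} (hS : S.Closed) {Δ : MCtx} : ∀ {Ψ : Ctx} {M : Nor}
    {C : Ty}, LSeq S Δ Ψ M C → ∀ {h : Status} {A B : Ty}, RightRule C h A B → TyWF S Δ Ψ C →
      LFDerivable S Δ (.snoc Ψ h A) B
  | _, _, _, .initS _ _ _ c _ hc, _, _, _, hC, hwf =>
    Assum.right_premise hS (.const _ _ c _ hc) hC hwf
  | _, _, _, .initV _ _ _ i _ hi, _, _, _, hC, hwf =>
    Assum.right_premise hS (.var _ _ i _ hi) hC hwf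
  | _, _, _, .piR _ _ _ _ _ _ h, _, _, _, .pi _ _, _ => ⟨_, h⟩
  | _, _, _, .arrR _ _ _ _ _ _ h, _, _, _, .arr _ _, _ => ⟨_, h⟩
  | Ψ, _, _, .piL _ _ _ _ M _ _ _ _ B' _ h₁ h₂ h₃ h₄ _, h, A, _, hC, hwf =>
    .piL (h₁.ren hS (.succ Ψ h A)) (h₂.ren hS (.succ Ψ h A)) (h₃.ren (Env.one_ren M Nat.succ))
      (.exchange hS (h₄.right_premise hS hC.shift (hwf.shift hS .proof B')))
  | Ψ, _, _, .arrL _ _ _ _ _ _ _ _ B _ h₁ h₂ h₃ _, h, A, _, hC, hwf =>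
    .arrL (h₁.ren hS (.succ Ψ h A)) ⟨_, h₂.ren hS (.succ Ψ h A)⟩
      (.exchange hS (h₃.right_premise hS hC.shift (hwf.shift hS .proof B)))
  | Ψ, _, _, .reflect _ _ _ _ _ t _ P' _ _ _ h₁ h₂ h₃ h₄ _, h, A, _, hC, hwf =>
    .reflect h₁ (h₂.ren hS (.succ Ψ h A)) (h₃.ren_result (Sub.env_ren Nat.succ t))
      (.exchange hS (h₄.right_premise hS hC.shift (hwf.shift hS .proof (.atom P'))))

/-! ### Closed schemas -/

/-- If the meta type is a schema, then it is closed. -/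
def MTy.SchemaClosed : MTy → Prop
  | .term _ _ => True
  | .schema G => ∀ Φ A, G.Elem Φ A → ∀ q, Φ.mren q = Φ ∧ A.mren q = A

/-- All schemas in the computation type are closed. -/
def CTy.SchemaClosed : CTy → Prop
  | .box _ _ => True
  | .arr t₁ t₂ => t₁.SchemaClosed ∧ t₂.SchemaClosed
  | .mpi U t => U.SchemaClosed ∧ t.SchemaClosed

theorem MTyWF.schemaClosed {S : Sig} {Δ : MCtx} {U : MTy} (h : MTyWF S Δ U) :
    U.SchemaClosed := by
  cases h with
  | term => trivial
  | schema _ h =>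
    intro Φ A hE q
    obtain ⟨hΦ, hA⟩ := h Φ A hE
    exact ⟨(hΦ.closed q).2, hA.mren_eq rfl (hΦ.closed q).1⟩

theorem CTyWF.schemaClosed {S : Sig} {Δ : MCtx} {t : CTy} (h : CTyWF S Δ t) :
    t.SchemaClosed := by
  induction h with
  | box => trivial
  | arr _ _ _ _ _ ih₁ ih₂ => exact ⟨ih₁, ih₂⟩
  | mpi _ _ _ h _ ih => exact ⟨h.schemaClosed, ih⟩

theorem MTy.SchemaClosed.mren {U : MTy} (h : U.SchemaClosed) (q : ℕ → ℕ) :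
    (U.mren q).SchemaClosed := by
  cases U with
  | term => trivial
  | schema => exact h

theorem CTy.SchemaClosed.mren : ∀ {t : CTy}, t.SchemaClosed → ∀ q : ℕ → ℕ,
    (t.mren q).SchemaClosed
  | .box _ _, _, _ => trivial
  | .arr _ _, h, q => ⟨h.1.mren q, h.2.mren q⟩
  | .mpi _ _, h, q => ⟨h.1.mren q, h.2.mren (up q)⟩

/-- Meta-substitution never alters a schema. Thus the invariant passes through `Π□L` without a proof
that `[[C/X]]τ` is well-formed, which would require a typed substitution theorem. -/
theorem MSCTy.schemaClosed {k : ℕ} {C : MTm} {t t' : CTy} (h : MSCTy k C t t') :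
    t.SchemaClosed → t'.SchemaClosed := by
  induction h with
  | box => exact id
  | arr _ _ _ _ _ _ _ _ ih₁ ih₂ => exact And.imp ih₁ ih₂
  | mpi _ _ _ _ _ _ h _ ih =>
    refine And.imp (fun hU => ?_) ih
    cases h with
    | term => trivial
    | schema => exact hU

/-- All schemas in the computation-level context are closed. -/
def CCtx.SchemaClosed (Γ : CCtx) : Prop := ∀ t ∈ Γ, t.SchemaClosed

theorem CCtx.SchemaClosed.cons {Γ : CCtx} {t : CTy} (h : Γ.SchemaClosed)
    (ht : t.SchemaClosed) : CCtx.SchemaClosed (t :: Γ) :=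
  List.forall_mem_cons.2 ⟨ht, h⟩

theorem CCtx.SchemaClosed.mshift {Γ : CCtx} (h : Γ.SchemaClosed) : Γ.mshift.SchemaClosed :=
  List.forall_mem_map.2 fun t ht => (h t ht).mren _

theorem CCtxWF.schemaClosed {S : Sig} {Δ : MCtx} {Γ : CCtx} (h : CCtxWF S Δ Γ) :
    Γ.SchemaClosed :=
  fun t ht => (h t ht).schemaClosed

/-! ### Renaming of contextual variables in meta terms and meta-substitutions -/

/-- The declarations of `Ψ` are renamed while the alternatives `∃Φ.A` of `G` stay; the two still
match because `Φ` and `A` contain no contextual variables. -/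
theorem CtxChk.mren {S : Sig} (hS : S.Closed) {Δ Δ' : MCtx} {q : ℕ → ℕ} (hq : MCtxRen q Δ Δ')
    {Ψ : Ctx} {G : Schema} (h : CtxChk S Δ Ψ G) (hG : (MTy.schema G).SchemaClosed) :
    CtxChk S Δ' (Ψ.mren q) G := by
  induction h with
  | nil => exact .nil _ _ _
  | cvar p G h => exact .cvar _ _ _ _ (hq _ _ h)
  | snoc Ψ Φ h A A' G t _ hE ht hA ih =>
    have e := hG Φ A hE q
    have ht' := ht.mren hS hq
    have hA' := hA.mren (Sub.env_mren q t)
    rw [e.1] at ht'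
    rw [e.2] at hA'
    exact .snoc _ _ _ _ _ _ _ _ _ (ih hG) hE ht' hA'

theorem MChk.mren {S : Sig} (hS : S.Closed) {Δ Δ' : MCtx} {q : ℕ → ℕ} (hq : MCtxRen q Δ Δ')
    {C : MTm} {U : MTy} (h : MChk S Δ C U) (hU : U.SchemaClosed) :
    MChk S Δ' (C.mren q) (U.mren q) := by
  cases h with
  | term Ψ R P h =>
    rw [MTm.mren_term, ← Ctx.erase_mren]
    exact .term _ _ _ _ _ (h.mren hS hq)
  | ctx _ _ h => exact .ctx _ _ _ _ (h.mren hS hq hU)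

/-- The renamings `r'` before and `r` after the removal of `k` resp. `k'` correspond. -/
structure DropRen (k k' : ℕ) (r' r : ℕ → ℕ) : Prop where
  self : r' k = k'
  other : ∀ i, i ≠ k → r' i ≠ k' ∧ drop k' (r' i) = r (drop k i)

theorem DropRen.up {k k' : ℕ} {r' r : ℕ → ℕ} (h : DropRen k k' r' r) :
    DropRen (k + 1) (k' + 1) (up r') (up r) where
  self := by simp [h.self]
  other i hi := by
    cases i with
    | zero => simp [drop]
    | succ i =>
      have hik : i ≠ k := by omega
      have := h.other i hik
      exact ⟨by simpa using this.1, by simp [drop_succ _ _ this.1, drop_succ _ _ hik, this.2]⟩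

theorem dropRen_zero (q : ℕ → ℕ) : DropRen 0 0 (up q) q where
  self := rfl
  other i hi := by
    obtain ⟨i, rfl⟩ := Nat.exists_eq_succ_of_ne_zero hi
    simp [drop]

mutual
-- Renaming commutes with meta-substitution, where `r'` acts before and `r` after the removal of the
-- substituted variable. For `Π□L` the pair is `up q` and `q`.
theorem MNeu.mren {k k' : ℕ} {r' r : ℕ → ℕ} (hr : DropRen k k' r' r) :
    ∀ {C : MTm} {n : ℕ} {R : Neu} {M : Nor}, MNeu k C n R M →
      MNeu k' (C.mren r) n (R.mren r') (M.mren r)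
  | _, _, _, _, .var _ _ _ _ => .var _ _ _ _
  | _, _, _, _, .const _ _ _ _ => .const _ _ _ _
  | _, _, _, _, .app _ _ _ _ _ _ _ _ h₁ h₂ h₃ =>
    .app _ _ _ _ _ _ _ _ (h₁.mren hr) (h₂.mren hr) (h₃.mren r)
  | C, n, _, _, .other _ _ _ u _ _ hu h => by
    have := MNeu.other k' (C.mren r) n (r' u) _ _ (hr.other u hu).1 (h.mren hr)
    rwa [(hr.other u hu).2] at this
  | _, n, _, _, .self _ e R _ _ t' _ h₁ h₂ => by
    have := MNeu.self k' (e.mren r) (R.mren r) n _ _ _ (h₁.mren hr) (h₂.mren (Sub.env_mren r t'))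
    rwa [← hr.self] at this ⊢
theorem MNor.mren {k k' : ℕ} {r' r : ℕ → ℕ} (hr : DropRen k k' r' r) :
    ∀ {C : MTm} {n : ℕ} {M M' : Nor}, MNor k C n M M' →
      MNor k' (C.mren r) n (M.mren r') (M'.mren r)
  | _, _, _, _, .neu _ _ _ _ _ h => .neu _ _ _ _ _ (h.mren hr)
  | _, _, _, _, .lam _ _ _ _ _ h => .lam _ _ _ _ _ (h.mren hr)
theorem MSub.mren {k k' : ℕ} {r' r : ℕ → ℕ} (hr : DropRen k k' r' r) :
    ∀ {C : MTm} {n : ℕ} {t t' : Sub}, MSub k C n t t' →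
      MSub k' (C.mren r) n (t.mren r') (t'.mren r)
  | _, _, _, _, .empty _ _ _ => .empty _ _ _
  | C, n, _, _, .other _ _ _ p hp => by
    have := MSub.other k' (C.mren r) n (r' p) (hr.other p hp).1
    rwa [(hr.other p hp).2] at this
  | _, n, _, _, .self _ Φ _ => by
    have := MSub.self k' (Φ.mren r) n
    rw [Φ.idSub_mren]
    rwa [← hr.self] at this ⊢
  | _, _, _, _, .snoc _ _ _ _ _ _ _ h₁ h₂ => .snoc _ _ _ _ _ _ _ (h₁.mren hr) (h₂.mren hr)
end

theorem MAtm.mren {k k' : ℕ} {r' r : ℕ → ℕ} (hr : DropRen k k' r' r) {C : MTm} {n : ℕ}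
    {P P' : Atm} (h : MAtm k C n P P') : MAtm k' (C.mren r) n (P.mren r') (P'.mren r) := by
  induction h with
  | const => exact .const _ _ _ _
  | app _ _ _ _ _ h ih => exact .app _ _ _ _ _ _ _ ih (h.mren hr)

theorem MSTy.mren {k k' : ℕ} {r' r : ℕ → ℕ} (hr : DropRen k k' r' r) {C : MTm} {n : ℕ}
    {A A' : Ty} (h : MSTy k C n A A') : MSTy k' (C.mren r) n (A.mren r') (A'.mren r) := by
  induction h with
  | atom _ _ _ h => exact .atom _ _ _ _ _ (h.mren hr)
  | pi _ _ _ _ _ _ _ ih₁ ih₂ => exact .pi _ _ _ _ _ _ _ ih₁ ih₂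
  | arr _ _ _ _ _ _ _ ih₁ ih₂ => exact .arr _ _ _ _ _ _ _ ih₁ ih₂

theorem MSCtx.mren {k k' : ℕ} {r' r : ℕ → ℕ} (hr : DropRen k k' r' r) {C : MTm}
    {Ψ Ψ' : Ctx} (h : MSCtx k C Ψ Ψ') : MSCtx k' (C.mren r) (Ψ.mren r') (Ψ'.mren r) := by
  induction h with
  | nil => exact .nil _ _
  | other C p hp =>
    have := MSCtx.other k' (C.mren r) (r' p) (hr.other p hp).1
    rwa [(hr.other p hp).2] at this
  | self Φ =>
    have := MSCtx.self k' (Φ.mren r)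
    rwa [← hr.self] at this ⊢
  | snoc _ Ψ _ _ _ _ _ h ih =>
    exact .snoc _ _ _ _ _ _ _ ih (by rw [Ψ.len_mren]; exact h.mren hr)

theorem MSMTy.mren {k k' : ℕ} {r' r : ℕ → ℕ} (hr : DropRen k k' r' r) {C : MTm}
    {U U' : MTy} (h : MSMTy k C U U') : MSMTy k' (C.mren r) (U.mren r') (U'.mren r) := by
  cases h with
  | term Ψ _ _ _ h₁ h₂ =>
    exact .term _ _ _ _ _ _ (h₁.mren hr) (by rw [Ψ.len_mren]; exact h₂.mren hr)
  | schema => exact .schema _ _ _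

theorem MSCTy.mren {k : ℕ} {C : MTm} {t t' : CTy} (h : MSCTy k C t t') : ∀ {k' : ℕ}
    {r' r : ℕ → ℕ}, DropRen k k' r' r → MSCTy k' (C.mren r) (t.mren r') (t'.mren r) := by
  induction h with
  | box _ _ Ψ _ _ _ h₁ h₂ =>
    exact fun hr =>
      .box _ _ _ _ _ _ (h₁.mren hr) (by rw [Ψ.len_mren]; exact h₂.mren hr)
  | arr _ _ _ _ _ _ _ _ ih₁ ih₂ => exact fun hr => .arr _ _ _ _ _ _ (ih₁ hr) (ih₂ hr)
  | mpi _ C _ _ _ _ h _ ih =>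
    intro k' r' r hr
    have := ih hr.up
    rw [MTm.mshift_mren] at this
    exact .mpi _ _ _ _ _ _ (h.mren hr) this

/-! ### The sequent calculus for computations without proof terms -/

namespace CompDerivable

variable {S : Sig} {Δ : MCtx} {Γ : CCtx}

theorem init {t : CTy} (h : t ∈ Γ) : CompDerivable S Δ Γ t :=
  let ⟨y, hy⟩ := List.mem_iff_getElem?.1 h
  ⟨_, .init _ _ _ y _ hy⟩

theorem mpiR {U : MTy} {t : CTy} (h : CompDerivable S (U :: Δ) Γ.mshift t) :
    CompDerivable S Δ Γ (.mpi U t) :=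
  let ⟨_, hE⟩ := h
  ⟨_, .mpiR _ _ _ _ _ _ hE⟩

theorem mpiL {U : MTy} {C : MTm} {t₁ t₁' t : CTy} (hy : CTy.mpi U t₁ ∈ Γ)
    (hC : MChk S Δ C U) (ht : MSCTy 0 C t₁ t₁') (h : CompDerivable S Δ (t₁' :: Γ) t) :
    CompDerivable S Δ Γ t :=
  let ⟨y, hy⟩ := List.mem_iff_getElem?.1 hy
  let ⟨_, hE⟩ := h
  ⟨_, .mpiL _ _ _ y _ _ _ _ _ _ hy hC ht hE⟩

theorem arrR {t₁ t₂ : CTy} (h : CompDerivable S Δ (t₁ :: Γ) t₂) :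
    CompDerivable S Δ Γ (.arr t₁ t₂) :=
  let ⟨_, hE⟩ := h
  ⟨_, .arrR _ _ _ _ _ _ hE⟩

theorem arrL {t₁ t₂ t : CTy} (hy : CTy.arr t₁ t₂ ∈ Γ) (h₁ : CompDerivable S Δ Γ t₁)
    (h₂ : CompDerivable S Δ (t₂ :: Γ) t) : CompDerivable S Δ Γ t :=
  let ⟨y, hy⟩ := List.mem_iff_getElem?.1 hy
  let ⟨_, hE₁⟩ := h₁
  let ⟨_, hE₂⟩ := h₂
  ⟨_, .arrL _ _ _ y _ _ _ _ _ hy hE₁ hE₂⟩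

theorem boxR {Ψ : Ctx} {R : Neu} {P : Atm} (h : LSeq S Δ Ψ (.neu R) (.atom P)) :
    CompDerivable S Δ Γ (.box Ψ P) :=
  ⟨_, .boxR _ _ _ _ _ _ h⟩

theorem boxL {Ψ : Ctx} {P : Atm} {t : CTy} (hy : CTy.box Ψ P ∈ Γ)
    (h : CompDerivable S (.term Ψ P :: Δ) Γ.mshift t.mshift) : CompDerivable S Δ Γ t :=
  let ⟨y, hy⟩ := List.mem_iff_getElem?.1 hy
  let ⟨_, hE⟩ := h
  ⟨_, .boxL _ _ _ y _ _ _ _ hy hE⟩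

end CompDerivable

/-- Weakening, exchange and contraction of `Γ` together: the rules only ask whether an assumption
occurs. Proof terms are not tracked. -/
theorem CSeq.mono {S : Sig} {Δ : MCtx} {Γ : CCtx} {E : Exp} {t : CTy} (h : CSeq S Δ Γ E t) :
    ∀ {Γ' : CCtx}, Γ ⊆ Γ' → CompDerivable S Δ Γ' t := by
  induction h with
  | init _ _ _ _ hy => exact fun hΓ => .init (hΓ (List.mem_of_getElem? hy))
  | mpiR _ _ _ _ _ _ ih => exact fun hΓ => .mpiR (ih (List.map_subset _ hΓ))
  | mpiL _ _ _ _ _ _ _ _ _ hy hC ht _ ih =>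
    exact fun hΓ => .mpiL (hΓ (List.mem_of_getElem? hy)) hC ht (ih (List.cons_subset_cons _ hΓ))
  | arrL _ _ _ _ _ _ _ _ hy _ _ ih₁ ih₂ =>
    exact fun hΓ => .arrL (hΓ (List.mem_of_getElem? hy)) (ih₁ hΓ)
      (ih₂ (List.cons_subset_cons _ hΓ))
  | arrR _ _ _ _ _ _ ih => exact fun hΓ => .arrR (ih (List.cons_subset_cons _ hΓ))
  | boxR _ _ _ _ _ h => exact fun _ => .boxR h
  | boxL _ _ _ _ _ _ _ hy _ ih =>
    exact fun hΓ => .boxL (hΓ (List.mem_of_getElem? hy)) (ih (List.map_subset _ hΓ))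

theorem CCtx.SchemaClosed.get {Γ : CCtx} (h : Γ.SchemaClosed) {y : ℕ} {t : CTy}
    (hy : Γ[y]? = some t) : t.SchemaClosed :=
  h t (List.mem_of_getElem? hy)

/-- The schemas met in a derivation come from the succedent and the context, so closedness there is
enough to rename every instantiation in `Π□L`. -/
theorem CSeq.mren {S : Sig} (hS : S.Closed) {Δ : MCtx} {Γ : CCtx} {E : Exp} {t : CTy}
    (h : CSeq S Δ Γ E t) : Γ.SchemaClosed → t.SchemaClosed → ∀ {Δ' : MCtx} {q : ℕ → ℕ},
      MCtxRen q Δ Δ' → CompDerivable S Δ' (Γ.map (CTy.mren q)) (t.mren q) := by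
  induction h with
  | init _ _ _ _ hy =>
    exact fun _ _ _ _ _ => .init (List.mem_map_of_mem (List.mem_of_getElem? hy))
  | mpiR Δ Γ U _ _ _ ih =>
    intro hΓ ht Δ' q hq
    have := ih hΓ.mshift ht.2 (hq.up U)
    rw [CCtx.mshift_mren] at this
    exact .mpiR this
  | mpiL _ _ _ _ _ _ _ _ _ hy hC ht _ ih =>
    intro hΓ ht' Δ' q hq
    have hc := hΓ.get hy
    exact .mpiL (List.mem_map_of_mem (List.mem_of_getElem? hy)) (hC.mren hS hq hc.1)
      (ht.mren (dropRen_zero q)) (ih (hΓ.cons (ht.schemaClosed hc.2)) ht' hq)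
  | arrL _ _ _ _ _ _ _ _ hy _ _ ih₁ ih₂ =>
    intro hΓ ht' Δ' q hq
    have hc := hΓ.get hy
    exact .arrL (List.mem_map_of_mem (List.mem_of_getElem? hy)) (ih₁ hΓ hc.1 hq)
      (ih₂ (hΓ.cons hc.2) ht' hq)
  | arrR _ _ _ _ _ _ ih => exact fun hΓ ht _ _ hq => .arrR (ih (hΓ.cons ht.1) ht.2 hq)
  | boxR _ _ _ _ _ h => exact fun _ _ _ _ hq => .boxR (h.mren hS hq)
  | boxL Δ Γ _ Ψ P _ t hy _ ih =>
    intro hΓ ht Δ' q hq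
    have := ih hΓ.mshift (ht.mren _) (hq.up _)
    rw [CCtx.mshift_mren, CTy.mshift_mren] at this
    exact .boxL (List.mem_map_of_mem (List.mem_of_getElem? hy)) this

/-! ### Invertibility of the right rules for computations -/

theorem CSeq.arr_premise {S : Sig} {Δ : MCtx} {Γ : CCtx} {E : Exp} {t : CTy}
    (h : CSeq S Δ Γ E t) : ∀ {t₁ t₂ : CTy}, t = .arr t₁ t₂ →
      CompDerivable S Δ (t₁ :: Γ) t₂ := by
  have swap : ∀ {Δ : MCtx} {Γ : CCtx} {t₁ t₂ t : CTy},
      CompDerivable S Δ (t₁ :: t₂ :: Γ) t → CompDerivable S Δ (t₂ :: t₁ :: Γ) t :=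
    fun ⟨_, h⟩ => h.mono (List.Perm.swap _ _ _).subset
  induction h with
  | init _ _ _ _ hy =>
    rintro t₁ t₂ rfl
    -- The function assumption is applied to the new assumption, and its result is the goal.
    exact .arrL (List.mem_cons_of_mem _ (List.mem_of_getElem? hy))
      (.init List.mem_cons_self) (.init List.mem_cons_self)
  | mpiR => rintro _ _ ⟨⟩
  | mpiL _ _ _ _ _ _ _ _ _ hy hC ht _ ih =>
    exact fun e => .mpiL (List.mem_cons_of_mem _ (List.mem_of_getElem? hy)) hC ht (swap (ih e))
  | arrL _ _ _ _ _ _ _ _ hy h₁ _ _ ih =>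
    exact fun e => .arrL (List.mem_cons_of_mem _ (List.mem_of_getElem? hy))
      (h₁.mono (List.subset_cons_self _ _)) (swap (ih e))
  | arrR _ _ _ _ _ h =>
    rintro _ _ ⟨⟩
    exact ⟨_, h⟩
  | boxR => rintro _ _ ⟨⟩
  | boxL _ _ _ _ _ _ _ hy _ ih =>
    rintro t₁ t₂ rfl
    exact .boxL (List.mem_cons_of_mem _ (List.mem_of_getElem? hy)) (ih rfl)

theorem CCtx.mem_mshift {Γ : CCtx} {y : ℕ} {t : CTy} (hy : Γ[y]? = some t) :
    t.mshift ∈ Γ.mshift :=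
  List.mem_map_of_mem (List.mem_of_getElem? hy)

theorem CCtx.mshift_mshift_swap (Γ : CCtx) :
    Γ.mshift.mshift.map (CTy.mren swap) = Γ.mshift.mshift := by
  simp [CCtx.mshift, CTy.mshift, CTy.mren_mren, swap_comp_succ_succ]

theorem CSeq.mpi_premise {S : Sig} (hS : S.Closed) {Δ : MCtx} {Γ : CCtx} {E : Exp} {t : CTy}
    (h : CSeq S Δ Γ E t) : ∀ {U : MTy} {t₁ : CTy}, t = .mpi U t₁ → Γ.SchemaClosed →
      CTyWF S Δ t → CompDerivable S (U :: Δ) Γ.mshift t₁ := by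
  induction h with
  | init Δ _ _ _ hy =>
    rintro U t₁ rfl _ hwf
    cases hwf with
    | mpi _ _ _ hU ht =>
    obtain ⟨C, hC, hid⟩ := hU.exists_identity hS
    -- The weakened assumption is instantiated with the new contextual variable in long form, and
    -- the identity law returns the type `t₁`.
    exact .mpiL (CCtx.mem_mshift hy) hC (ht.meta_id hid) (.init List.mem_cons_self)
  | mpiR _ _ _ _ _ h =>
    rintro _ _ ⟨⟩ _ _
    exact ⟨_, h⟩
  | mpiL Δ _ _ _ _ _ _ _ _ hy hC ht _ ih =>
    intro U t₁ e hΓ hwf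
    have hc := hΓ.get hy
    exact .mpiL (CCtx.mem_mshift hy) (hC.mren hS (.succ Δ U) hc.1)
      (ht.mren (dropRen_zero _)) (ih e (hΓ.cons (ht.schemaClosed hc.2)) hwf)
  | arrL Δ _ _ _ _ _ _ _ hy h₁ _ _ ih =>
    intro U t₁ e hΓ hwf
    have hc := hΓ.get hy
    exact .arrL (CCtx.mem_mshift hy) (h₁.mren hS hΓ hc.1 (.succ Δ U)) (ih e (hΓ.cons hc.2) hwf)
  | arrR => rintro _ _ ⟨⟩
  | boxR => rintro _ _ ⟨⟩
  | boxL Δ Γ _ Ψ P _ t hy _ ih =>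
    rintro U t₁ rfl hΓ hwf
    obtain ⟨E, hE⟩ := ih rfl hΓ.mshift (hwf.mren hS (.succ Δ (.term Ψ P)))
    -- The induction hypothesis declares `U` after the unboxed variable, while `□L` has to introduce
    -- that variable last. The doubly weakened `Γ` mentions neither, so exchanging them leaves it
    -- unchanged.
    have := hE.mren hS hΓ.mshift.mshift (hwf.schemaClosed.mren _).2 (.swap Δ (.term Ψ P) U)
    rw [CCtx.mshift_mshift_swap, CTy.mren_mren, swap_comp_up_succ] at this
    exact .boxL (CCtx.mem_mshift hy) this

end Beluga

-- The five invertibility statements.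

theorem mainTheorem3 (S : Beluga.Sig) (hS : Beluga.SigWF S) :
    (∀ (Δ : Beluga.MCtx) (Ψ : Beluga.Ctx) (A B : Beluga.Ty),
      Beluga.LFSequentWF S Δ Ψ (.pi A B) →
      Beluga.LFDerivable S Δ Ψ (.pi A B) →
      Beluga.LFDerivable S Δ (.snoc Ψ .param A) B) ∧
    (∀ (Δ : Beluga.MCtx) (Ψ : Beluga.Ctx) (A B : Beluga.Ty),
      Beluga.LFSequentWF S Δ Ψ (.arr A B) →
      Beluga.LFDerivable S Δ Ψ (.arr A B) →
      Beluga.LFDerivable S Δ (.snoc Ψ .proof A) B.shift) ∧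
    (∀ (Δ : Beluga.MCtx) (Γ : Beluga.CCtx) (U : Beluga.MTy) (t : Beluga.CTy),
      Beluga.CompSequentWF S Δ Γ (.mpi U t) →
      Beluga.CompDerivable S Δ Γ (.mpi U t) →
      Beluga.CompDerivable S (U :: Δ) Γ.mshift t) ∧
    (∀ (Δ : Beluga.MCtx) (Γ : Beluga.CCtx) (t₁ t₂ : Beluga.CTy),
      Beluga.CompSequentWF S Δ Γ (.arr t₁ t₂) →
      Beluga.CompDerivable S Δ Γ (.arr t₁ t₂) →
      Beluga.CompDerivable S Δ (t₁ :: Γ) t₂) ∧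
    (∀ (Δ : Beluga.MCtx) (Γ : Beluga.CCtx) (Ψ : Beluga.Ctx) (P : Beluga.Atm) (t : Beluga.CTy),
      Beluga.CompSequentWF S Δ (.box Ψ P :: Γ) t →
      Beluga.CompDerivable S Δ (.box Ψ P :: Γ) t →
      Beluga.CompDerivable S (.term Ψ P :: Δ) (Beluga.CCtx.mshift (.box Ψ P :: Γ)) t.mshift) := by
  have hc := hS.closed
  refine ⟨fun Δ Ψ A B hwf ⟨_, h⟩ => h.right_premise hc (.pi A B) hwf.goal,
    fun Δ Ψ A B hwf ⟨_, h⟩ => h.right_premise hc (.arr A B) hwf.goal,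
    fun Δ Γ U t hwf ⟨_, h⟩ => h.mpi_premise hc rfl hwf.ctx.schemaClosed hwf.goal,
    fun Δ Γ t₁ t₂ _ ⟨_, h⟩ => h.arr_premise rfl,
    fun Δ Γ Ψ P t hwf ⟨_, h⟩ =>
      -- The boxed assumption remains in the context, so this is weakening by one contextual
      -- variable.
      h.mren hc hwf.ctx.schemaClosed hwf.goal.schemaClosed (.succ Δ (.term Ψ P))⟩
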